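/- Conventions. A valued field $(K,v)$ is a field $K$ with a surjective valuation $v\colon K\to\Gamma\cup\{\infty\}$ onto an ordered abelian group $\Gamma$ together with $\infty$. It is \emph{computable} if $K$ and $\Gamma$ are computable subsets of $\mathbb{N}$, the operations $+,\cdot$ of $K$ and the addition and the order of $\Gamma$ are computable, and $v$ is computable. It is \emph{formally $p$-adic} if $K\supseteq\mathbb{Q}$, $v$ extends the $p$-adic valuation of $\mathbb{Q}$, the residue field is $\mathbb{F}_p$, and $v(p)$ is the least positive element of $\Gamma$. It is \emph{$p$-adically closed} if in addition it is Henselian and $\Gamma$ is a model of Presburger arithmetic, i.e. for all $x\in\Gamma$ and $n\ge 1$ there are $y\in\Gamma$ and $0\le r<n$ with $x=ny+r\,v(p)$. An embedding of valued fields $(E,v)\to(L,w)$ is a field embedding $f$ with $v(x)\le v(y)\iff w(f(x))\le w(f(y))$ for all $x,y\in E$. Theorem. For every prime $p$ there is a computable formally $p$-adic valued field $(E,v)$ such that there is no embedding of valued fields (computable or not), and in particular no computable embedding, of $(E,v)$ into a computable $p$-adically closed valued field; thus $(E,v)$ has no computable embedding into a computable $p$-adic closure. Moreover, $E$ can be chosen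 algebraic over $\mathbb{Q}(t)$ for some $t\in E$ that is transcendental over $\mathbb{Q}$ and satisfies $v(t)>n\,v(p)$ for all $n\in\mathbb{N}$. -/

import Mathlib

/-- An identification of `A` with a computable subset of `ℕ`. -/
structure ComputableDomain (A : Type) where
  code : A ↪ ℕ
  computable_range : ComputablePred fun n : ℕ => n ∈ Set.range code

/-- A binary operation on a domain is computable if it is the restriction of a computable
function on codes. (The domain being computable, total and partial functions on codes give the
same notion.) -/
def ComputableDomain.ComputableOp {A : Type} (d : ComputableDomain A) (op : A → A → A) : Prop :=
  ∃ F : ℕ → ℕ → ℕ, Computable₂ F ∧ ∀ x y, F (d.code x) (d.code y) = d.code (op x y)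

/-- A binary relation on a domain is computable if it is decided by a computable function on
codes. -/
def ComputableDomain.ComputableRel {A : Type} (d : ComputableDomain A) (r : A → A → Prop) : Prop :=
  ∃ F : ℕ → ℕ → Bool, Computable₂ F ∧ ∀ x y, F (d.code x) (d.code y) = true ↔ r x y

/-- A computable valued field: a field `K` and an ordered abelian group `Γ`, both with domain a
computable set of natural numbers and with computable operations (and computable order on `Γ`),
and a surjective computable valuation `v : K → Γ ∪ {∞}`. -/
structure ComputableValuedField where
  K : Type
  Γ : Type
  [field : Field K]
  [addCommGroup : AddCommGroup Γ]
  [linearOrder : LinearOrder Γ]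
  [isOrdered : IsOrderedAddMonoid Γ]
  v : AddValuation K (WithTop Γ)
  surjective : Function.Surjective v
  domK : ComputableDomain K
  domΓ : ComputableDomain Γ
  add_computable : domK.ComputableOp (fun x y => x + y)
  mul_computable : domK.ComputableOp (fun x y => x * y)
  group_add_computable : domΓ.ComputableOp (fun a b => a + b)
  group_le_computable : domΓ.ComputableRel (fun a b => a ≤ b)
  /-- On the nonzero elements, where `v` takes its values in `Γ`, the map `v` is computable. -/
  v_computable : ∃ F : ℕ → ℕ, Computable F ∧
    ∀ (x : K) (γ : Γ), v x = (γ : WithTop Γ) → F (domK.code x) = domΓ.code γ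

attribute [instance] ComputableValuedField.field ComputableValuedField.addCommGroup
  ComputableValuedField.linearOrder ComputableValuedField.isOrdered

section

variable {K Γ : Type} [Field K] [AddCommGroup Γ] [LinearOrder Γ] [IsOrderedAddMonoid Γ]

/-- The valuation ring `{x | 0 ≤ v x}`. -/
abbrev valRing (v : AddValuation K (WithTop Γ)) : ValuationSubring K :=
  (AddValuation.toValuation v).valuationSubring

/-- `(K, v)` is formally `p`-adic: `K` contains `ℚ` and `v` extends the `p`-adic valuation of `ℚ`
(with `1 ∈ ℤ` identified with `γ = v p`), the residue field is `𝔽_p`, and `v p` is the least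
positive element of the value group. -/
def IsFormallyPAdic (p : ℕ) (v : AddValuation K (WithTop Γ)) : Prop :=
  CharZero K ∧
  ∃ γ : Γ,
    (∀ q : ℚ, q ≠ 0 → v (q : K) = ((padicValRat p q • γ : Γ) : WithTop Γ)) ∧
    Nonempty (IsLocalRing.ResidueField (valRing v) ≃+* ZMod p) ∧
    v (p : K) = (γ : WithTop Γ) ∧ IsLeast {g : Γ | 0 < g} γ

end

/-- `Γ` is a model of Presburger arithmetic: a discretely ordered abelian group with least positive
element `e` in which division with remainder by every positive integer is possible. -/
def IsPresburgerGroup (Γ : Type) [AddCommGroup Γ] [LinearOrder Γ] [IsOrderedAddMonoid Γ] : Prop :=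
  ∃ e : Γ, IsLeast {g : Γ | 0 < g} e ∧
    ∀ (x : Γ) (n : ℕ), 0 < n → ∃ (y : Γ) (r : ℕ), r < n ∧ x = n • y + r • e

/-- `(K, v)` is `p`-adically closed: formally `p`-adic and Henselian, with value group a model of
Presburger arithmetic. -/
def IsPAdicallyClosed {K Γ : Type} [Field K] [AddCommGroup Γ] [LinearOrder Γ]
    [IsOrderedAddMonoid Γ] (p : ℕ) (v : AddValuation K (WithTop Γ)) : Prop :=
  IsFormallyPAdic p v ∧ HenselianLocalRing (valRing v) ∧ IsPresburgerGroup Γ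

/-- `f` is an embedding of valued fields `(E, v) → (L, w)`. -/
def IsValuedFieldEmbedding (E L : ComputableValuedField) (f : E.K →+* L.K) : Prop :=
  ∀ x y : E.K, E.v x ≤ E.v y ↔ L.v (f x) ≤ L.v (f y)

/-! The value of one transcendental is made to encode a diagonal problem that no computable division
with remainder can survive. Let `F n` be the `n`-th Fermat number; these are pairwise coprime. Run
all programs on their own indices. Whenever program `n` halts on `n` with output `e`, require `v t`
to be congruent to `e * v p` modulo `F n`. At stage `s` the requirements found so far amount to one
congruence, with modulus `M s` and residue `r s`. It is realised by a generator `t_s` with `t = p ^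
r s * t_s ^ M s`, and `E` is generated by all the `t_s`.

No embedding: this equation survives every ring homomorphism into a field `L`. If `L` is computable
with Presburger value group, searching for a quotient and a remainder computes the remainder `g n`
of the value of `t` modulo `F n`, for all `n`. The function `h` that is `1` where `g` vanishes and
`0` elsewhere is computable, so it has a program with some index `n`. The congruence imposed for
that `n` gives `g n = h n`, which is absurd (`not_exists_ringHom_germField`).

Computability: `t_s` is represented by the sequence `p ^ stageExponent s j` in an ultrapower of `ℚ`.
Elements of `E` are quotients of expressions in finitely many generators, and each expression
becomes a polynomial in a single late `t_s`. At a large power `p ^ n` the valuation of a polynomial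
is `n * d + a` with `a < n`, where `d` and `a` do not depend on `n`. Hence comparisons stabilise
from a computable index on (`pAdicLE_evalRing_iff`), and order, equality and valuation in `E` are
decidable although halting is not. Subfields of the ultrapower are formally `p`-adic because the
needed properties pass from `ℚ` to germs (`isFormallyPAdic_restrictVal`). -/

open Nat.Partrec (Code)

/-! ### Congruences enumerated by halting computations -/

/-- One stage of the construction of the congruences imposed on the value of the transcendental:
if the `n`-th program is seen to output `e` on input `n`, the residue is made congruent to `e`
modulo the `n`-th Fermat number. -/
def congruenceStep (s : ℕ) (x : ℕ × ℕ) : ℕ × ℕ :=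
  -- A stage codes a pair consisting of a program index and a time bound, so every pair is visited
  -- once.
  Option.casesOn (Code.evaln s.unpair.2 (Denumerable.ofNat Code s.unpair.1) s.unpair.1) x
    fun e => if x.1 % s.unpair.1.fermatNumber = 0 then x else
      (x.1 * s.unpair.1.fermatNumber,
        -- With `q` the Fermat number, coprime to the old modulus `x.1`, the power `x.1 ^ q!` is `1`
        -- modulo `q` and `0` modulo `x.1`. The new residue is thus `e + q * x.2`, that is `e`,
        -- modulo `q`, and is unchanged modulo `x.1`. The factor `q - 1` stands in for `-1` within
        -- `ℕ`.
        x.2 + x.1 ^ s.unpair.1.fermatNumber.factorial *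
          (e + (s.unpair.1.fermatNumber - 1) * x.2))

/-- The modulus and the residue after `s` stages. -/
def congruenceSeq (s : ℕ) : ℕ × ℕ :=
  Nat.rec (1, 0) congruenceStep s

def stageModulus (s : ℕ) : ℕ := (congruenceSeq s).1

def stageResidue (s : ℕ) : ℕ := (congruenceSeq s).2

section Computability

theorem Primrec.nat_pow : Primrec₂ ((· ^ ·) : ℕ → ℕ → ℕ) :=
  Primrec₂.unpaired'.1 Nat.Primrec.pow

theorem Primrec.nat_factorial : Primrec Nat.factorial :=
  (Primrec.nat_rec₁ (f := fun n m => (n + 1) * m) 1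
    (Primrec.nat_mul.comp (Primrec.succ.comp Primrec.fst) Primrec.snd)).of_eq fun n => by
      induction n with
      | zero => rfl
      | succ n ih => simp only [Nat.factorial_succ, ← ih]

theorem Primrec.fermatNumber : Primrec Nat.fermatNumber :=
  Primrec.succ.comp (Primrec.nat_pow.comp (Primrec.const 2)
    (Primrec.nat_pow.comp (Primrec.const 2) Primrec.id))

theorem Primrec.congruenceStep : Primrec₂ congruenceStep := by
  have hn : Primrec fun y : ℕ × (ℕ × ℕ) => y.1.unpair.1 :=
    Primrec.fst.comp (Primrec.unpair.comp Primrec.fst)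
  have hk : Primrec fun y : ℕ × (ℕ × ℕ) => y.1.unpair.2 :=
    Primrec.snd.comp (Primrec.unpair.comp Primrec.fst)
  have hev : Primrec fun y : ℕ × (ℕ × ℕ) =>
      Code.evaln y.1.unpair.2 (Denumerable.ofNat Code y.1.unpair.1) y.1.unpair.1 :=
    Code.primrec_evaln.comp (((hk.pair ((Primrec.ofNat Code).comp hn))).pair hn)
  have hq : Primrec fun z : (ℕ × (ℕ × ℕ)) × ℕ => z.1.1.unpair.1.fermatNumber :=
    Primrec.fermatNumber.comp (hn.comp Primrec.fst)
  have hx1 : Primrec fun z : (ℕ × (ℕ × ℕ)) × ℕ => z.1.2.1 :=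
    Primrec.fst.comp (Primrec.snd.comp Primrec.fst)
  have hx2 : Primrec fun z : (ℕ × (ℕ × ℕ)) × ℕ => z.1.2.2 :=
    Primrec.snd.comp (Primrec.snd.comp Primrec.fst)
  refine Primrec.option_casesOn hev Primrec.snd (Primrec.ite ?_ (Primrec.snd.comp Primrec.fst) ?_)
  · exact Primrec.eq.comp (Primrec.nat_mod.comp hx1 hq) (Primrec.const 0)
  · exact (Primrec.nat_mul.comp hx1 hq).pair (Primrec.nat_add.comp hx2
      (Primrec.nat_mul.comp (Primrec.nat_pow.comp hx1 (Primrec.nat_factorial.comp hq))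
        (Primrec.nat_add.comp Primrec.snd
          (Primrec.nat_mul.comp (Primrec.nat_sub.comp hq (Primrec.const 1)) hx2))))

theorem Primrec.congruenceSeq : Primrec congruenceSeq :=
  Primrec.nat_rec₁ _ Primrec.congruenceStep

end Computability

/-- Either `q` is coprime to the modulus, or it divides it and the residue modulo `q` is as
demanded by the program. -/
def CongruenceInvariant (x : ℕ × ℕ) : Prop :=
  0 < x.1 ∧ ∀ n : ℕ, x.1.Coprime n.fermatNumber ∨ n.fermatNumber ∣ x.1 ∧
    ∃ e ∈ Code.eval (Denumerable.ofNat Code n) n, x.2 ≡ e [MOD n.fermatNumber]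

theorem Nat.pow_factorial_modEq_one {a q : ℕ} (hq : 0 < q) (h : a.Coprime q) :
    a ^ q.factorial ≡ 1 [MOD q] := by
  obtain ⟨c, hc⟩ := Nat.dvd_factorial (Nat.totient_pos.2 hq) (Nat.totient_le q)
  rw [hc, pow_mul]
  simpa using (Nat.ModEq.pow_totient h).pow c

theorem congruenceStep_eq (s : ℕ) (x : ℕ × ℕ) :
    congruenceStep s x = x ∨ ∃ e ∈ Code.eval (Denumerable.ofNat Code s.unpair.1) s.unpair.1,
      ¬ s.unpair.1.fermatNumber ∣ x.1 ∧ congruenceStep s x =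
      (x.1 * s.unpair.1.fermatNumber, x.2 + x.1 ^ s.unpair.1.fermatNumber.factorial *
          (e + (s.unpair.1.fermatNumber - 1) * x.2)) := by
  unfold congruenceStep
  rcases h : Code.evaln s.unpair.2 (Denumerable.ofNat Code s.unpair.1) s.unpair.1 with _ | e
  · exact Or.inl rfl
  · by_cases hd : x.1 % s.unpair.1.fermatNumber = 0
    · left; simp [hd]
    · right
      exact ⟨e, Code.evaln_sound h, fun hh => hd (Nat.mod_eq_zero_of_dvd hh), by simp [hd]⟩

/-- Pairwise coprimality of Fermat numbers keeps the other moduli coprime to the new one.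
Requirements already met persist because the residue changes by a multiple of the old modulus. -/
theorem CongruenceInvariant.step {x : ℕ × ℕ} (hx : CongruenceInvariant x) (s : ℕ) :
    CongruenceInvariant (congruenceStep s x) ∧
      ∃ k m : ℕ, 0 < m ∧ congruenceStep s x = (x.1 * m, x.2 + x.1 * k) := by
  rcases congruenceStep_eq s x with h | ⟨e, he, hd, h⟩
  · rw [h]
    exact ⟨hx, 0, 1, one_pos, by simp⟩
  set n := s.unpair.1 with hn
  set q := n.fermatNumber with hq
  have hq0 : 0 < q := by have := Nat.three_le_fermatNumber n; omega
  have hcop : x.1.Coprime q := (hx.2 n).resolve_right fun hh => hd hh.1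
  obtain ⟨c, hc⟩ : x.1 ∣ x.1 ^ q.factorial := dvd_pow_self _ (Nat.factorial_ne_zero q)
  refine ⟨?_, c * (e + (q - 1) * x.2), q, hq0, by rw [h, ← mul_assoc, ← hc]⟩
  rw [h]
  refine ⟨Nat.mul_pos hx.1 hq0, fun m => ?_⟩
  by_cases hmn : m = n
  · subst hmn
    refine Or.inr ⟨Dvd.intro_left _ rfl, e, he, ?_⟩
    calc x.2 + x.1 ^ q.factorial * (e + (q - 1) * x.2)
        ≡ x.2 + 1 * (e + (q - 1) * x.2) [MOD q] :=
          ((Nat.pow_factorial_modEq_one hq0 hcop).mul_right _).add_left _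
      _ = e + q * x.2 := by
          obtain ⟨q', hq'⟩ : ∃ q', q = q' + 1 := ⟨q - 1, by omega⟩
          rw [hq', Nat.add_sub_cancel]; ring
      _ ≡ e [MOD q] := by simp [Nat.ModEq]
  · rcases hx.2 m with h1 | ⟨h1, e', he', h2⟩
    · exact Or.inl (Nat.Coprime.mul_left h1
        (Nat.coprime_fermatNumber_fermatNumber (Ne.symm hmn)))
    · refine Or.inr ⟨h1.mul_right _, e', he', ?_⟩
      have : x.2 + x.1 ^ q.factorial * (e + (q - 1) * x.2) ≡ x.2 + 0 [MOD m.fermatNumber] :=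
        Nat.ModEq.add_left _ (Nat.modEq_zero_iff_dvd.2
          ((h1.trans (dvd_pow_self _ (Nat.factorial_ne_zero q))).mul_right _))
      exact this.trans h2

theorem congruenceInvariant_seq (s : ℕ) : CongruenceInvariant (congruenceSeq s) := by
  induction s with
  | zero => exact ⟨one_pos, fun n => Or.inl (Nat.coprime_one_left _)⟩
  | succ s ih => exact (ih.step s).1

theorem stageModulus_pos (s : ℕ) : 0 < stageModulus s := (congruenceInvariant_seq s).1

/-- Later congruences refine earlier ones; this is what makes an earlier generator a power of `p`
times a power of a later one. -/
theorem exists_stage_affine {s s' : ℕ} (h : s ≤ s') : ∃ k m : ℕ, 0 < m ∧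
    stageModulus s' = stageModulus s * m ∧ stageResidue s' = stageResidue s + stageModulus s * k := by
  induction s', h using Nat.le_induction with
  | base => exact ⟨0, 1, one_pos, by simp⟩
  | succ s' _ ih =>
    obtain ⟨k, m, hm, h1, h2⟩ := ih
    obtain ⟨k', m', hm', h'⟩ := ((congruenceInvariant_seq s').step s').2
    refine ⟨k + m * k', m * m', Nat.mul_pos hm hm', ?_, ?_⟩
    · calc stageModulus (s' + 1) = stageModulus s' * m' := congrArg Prod.fst h'
        _ = _ := by rw [h1, mul_assoc]
    · calc stageResidue (s' + 1) = stageResidue s' + stageModulus s' * k' := congrArg Prod.snd h'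
        _ = _ := by rw [h1, h2]; ring

/-- Every halting computation of a program on itself is eventually recorded. -/
theorem exists_stage_of_mem_eval {n e : ℕ} (h : e ∈ Code.eval (Denumerable.ofNat Code n) n) :
    ∃ s, n.fermatNumber ∣ stageModulus s ∧ stageResidue s ≡ e [MOD n.fermatNumber] := by
  obtain ⟨k, hk⟩ := Code.evaln_complete.1 h
  have hdvd : n.fermatNumber ∣ stageModulus (Nat.pair n k + 1) := by
    change _ ∣ (congruenceStep (Nat.pair n k) (congruenceSeq (Nat.pair n k))).1
    simp only [congruenceStep, Nat.unpair_pair, Option.mem_def.1 hk]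
    split_ifs with hd
    · exact Nat.dvd_of_mod_eq_zero hd
    · exact Dvd.intro_left _ rfl
  refine ⟨Nat.pair n k + 1, hdvd, ?_⟩
  rcases (congruenceInvariant_seq (Nat.pair n k + 1)).2 n with h1 | ⟨_, e', he', h2⟩
  · exact absurd (Nat.eq_one_of_dvd_coprimes h1 hdvd dvd_rfl) (Nat.fermatNumber_ne_one n)
  · rwa [Part.mem_unique h he']

/-! ### Exponents realising the congruences -/

/-- The exponent of the `s`-th generator at the index `j`. -/
def stageExponent (s j : ℕ) : ℕ :=
  -- The number `stageResidue j + stageModulus j * j` satisfies every congruence imposed by stage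
  -- `j` and is at least `j`. The division is exact for `s ≤ j`; values at smaller `j` are junk that
  -- germs ignore.
  (stageResidue j + stageModulus j * j - stageResidue s) / stageModulus s

theorem Primrec.stageExponent : Primrec₂ stageExponent := by
  have hM : Primrec stageModulus := Primrec.fst.comp Primrec.congruenceSeq
  have hr : Primrec stageResidue := Primrec.snd.comp Primrec.congruenceSeq
  exact Primrec.nat_div.comp (Primrec.nat_sub.comp (Primrec.nat_add.comp (hr.comp Primrec.snd)
    (Primrec.nat_mul.comp (hM.comp Primrec.snd) Primrec.snd)) (hr.comp Primrec.fst))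
    (hM.comp Primrec.fst)

theorem stageExponent_spec {s j : ℕ} (h : s ≤ j) :
    stageResidue s + stageModulus s * stageExponent s j = stageResidue j + stageModulus j * j := by
  obtain ⟨k, m, -, h1, h2⟩ := exists_stage_affine h
  have : stageResidue j + stageModulus j * j - stageResidue s = stageModulus s * (k + m * j) := by
    rw [h1, h2, mul_add, ← mul_assoc]; omega
  rw [stageExponent, this, Nat.mul_div_cancel_left _ (stageModulus_pos s), h1, h2]
  ring

/-- The point is that `k` and `m` do not depend on `j`, so the relation between two generators holds
as an identity of monomials. -/
theorem exists_stageExponent_affine {s s' : ℕ} (h : s ≤ s') : ∃ k m : ℕ, ∀ j, s' ≤ j →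
    stageExponent s j = k + m * stageExponent s' j := by
  obtain ⟨k, m, -, h1, h2⟩ := exists_stage_affine h
  refine ⟨k, m, fun j hj => Nat.eq_of_mul_eq_mul_left (stageModulus_pos s) ?_⟩
  have e1 := stageExponent_spec (h.trans hj)
  have e2 := stageExponent_spec hj
  rw [h1, h2, mul_assoc] at e2
  rw [mul_add]
  linarith

theorem le_stageExponent {s j : ℕ} (h : s ≤ j) : j ≤ stageExponent s j := by
  obtain ⟨k, m, hm, h1, h2⟩ := exists_stage_affine h
  refine Nat.le_of_mul_le_mul_left ?_ (stageModulus_pos s)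
  have e1 := stageExponent_spec h
  rw [h1, h2] at e1
  have : stageModulus s * j ≤ stageModulus s * m * j := by
    rw [mul_assoc]
    exact Nat.mul_le_mul_left _ (Nat.le_mul_of_pos_left _ hm)
  have : 0 ≤ stageModulus s * k := Nat.zero_le _
  linarith

theorem stageExponent_zero {s j : ℕ} (h : s ≤ j) :
    stageExponent 0 j = stageResidue s + stageModulus s * stageExponent s j := by
  have := stageExponent_spec (Nat.zero_le j)
  rw [stageExponent_spec h, ← this]
  -- Stage `0` has modulus `1` and residue `0`.
  change _ = 0 + 1 * _
  ring

/-! ### Integral polynomials in the generators -/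

/-- Sums of monomials in the generators; a monomial is the list of its factors. -/
abbrev PosExpr := List (List ℕ)

/-- Formal differences of sums of monomials. -/
abbrev RingExpr := PosExpr × PosExpr

def evalMonomial (p : ℕ) (l : List ℕ) (j : ℕ) : ℕ :=
  p ^ (l.map fun s => stageExponent s j).sum

def evalPos (p : ℕ) (P : PosExpr) (j : ℕ) : ℕ :=
  (P.map fun l => evalMonomial p l j).sum

def evalRing (p : ℕ) (a : RingExpr) (j : ℕ) : ℤ :=
  (evalPos p a.1 j : ℤ) - evalPos p a.2 j

def mulPos (P Q : PosExpr) : PosExpr := P.flatMap fun l => Q.map fun m => l ++ m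

def RingExpr.add (a b : RingExpr) : RingExpr := (a.1 ++ b.1, a.2 ++ b.2)

def RingExpr.mul (a b : RingExpr) : RingExpr :=
  (mulPos a.1 b.1 ++ mulPos a.2 b.2, mulPos a.1 b.2 ++ mulPos a.2 b.1)

section Eval

variable (p : ℕ)

theorem evalPos_append (P Q : PosExpr) (j : ℕ) :
    evalPos p (P ++ Q) j = evalPos p P j + evalPos p Q j := by
  simp [evalPos]

theorem evalMonomial_append (l m : List ℕ) (j : ℕ) :
    evalMonomial p (l ++ m) j = evalMonomial p l j * evalMonomial p m j := by
  simp [evalMonomial, pow_add]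

theorem evalPos_cons (l : List ℕ) (P : PosExpr) (j : ℕ) :
    evalPos p (l :: P) j = evalMonomial p l j + evalPos p P j := by
  simp [evalPos]

theorem evalPos_mulPos (P Q : PosExpr) (j : ℕ) :
    evalPos p (mulPos P Q) j = evalPos p P j * evalPos p Q j := by
  induction P with
  | nil => simp [mulPos, evalPos]
  | cons l P ih =>
    have h : evalPos p (Q.map fun m => l ++ m) j = evalMonomial p l j * evalPos p Q j := by
      simp only [evalPos, List.map_map, Function.comp_def, evalMonomial_append,
        List.sum_map_mul_left]
    have : mulPos (l :: P) Q = (Q.map fun m => l ++ m) ++ mulPos P Q := rfl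
    rw [this, evalPos_append, h, ih, evalPos_cons, add_mul]

theorem evalRing_add (a b : RingExpr) (j : ℕ) :
    evalRing p (a.add b) j = evalRing p a j + evalRing p b j := by
  simp only [evalRing, RingExpr.add, evalPos_append, Nat.cast_add]; ring

theorem evalRing_mul (a b : RingExpr) (j : ℕ) :
    evalRing p (a.mul b) j = evalRing p a j * evalRing p b j := by
  simp only [evalRing, RingExpr.mul, evalPos_append, evalPos_mulPos, Nat.cast_add, Nat.cast_mul]
  ring

theorem evalRing_swap (a : RingExpr) (j : ℕ) : evalRing p a.swap j = -evalRing p a j := by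
  simp [evalRing]

end Eval

/-! ### Primitive recursiveness of evaluation -/

section Computability

theorem Primrec.list_sum_map {α β : Type*} [Primcodable α] [Primcodable β] {f : α → List β}
    {g : α → β → ℕ} (hf : Primrec f) (hg : Primrec₂ g) :
    Primrec fun a => ((f a).map (g a)).sum :=
  Primrec.list_foldr (Primrec.list_map hf hg) (Primrec.const 0)
    (Primrec.nat_add.comp (Primrec.fst.comp Primrec.snd) (Primrec.snd.comp Primrec.snd)).to₂

theorem Primrec.evalMonomial (p : ℕ) : Primrec₂ (evalMonomial p) :=
  Primrec.nat_pow.comp (Primrec.const p) (Primrec.list_sum_map Primrec.fst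
    (Primrec.stageExponent.comp Primrec.snd (Primrec.snd.comp Primrec.fst)))

theorem Primrec.evalPos (p : ℕ) : Primrec₂ (evalPos p) :=
  Primrec.list_sum_map Primrec.fst
    ((Primrec.evalMonomial p).comp Primrec.snd (Primrec.snd.comp Primrec.fst))

theorem Primrec.mulPos : Primrec₂ mulPos :=
  Primrec.list_flatMap Primrec.fst (Primrec.list_map (Primrec.snd.comp Primrec.fst)
    (Primrec.list_append.comp (Primrec.snd.comp Primrec.fst) Primrec.snd))

theorem Primrec.ringExpr_add : Primrec₂ RingExpr.add :=
  (Primrec.list_append.comp (Primrec.fst.comp Primrec.fst) (Primrec.fst.comp Primrec.snd)).pair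
    (Primrec.list_append.comp (Primrec.snd.comp Primrec.fst) (Primrec.snd.comp Primrec.snd))

theorem Primrec.ringExpr_mul : Primrec₂ RingExpr.mul := by
  have h11 : Primrec fun x : RingExpr × RingExpr => x.1.1 := Primrec.fst.comp Primrec.fst
  have h12 : Primrec fun x : RingExpr × RingExpr => x.1.2 := Primrec.snd.comp Primrec.fst
  have h21 : Primrec fun x : RingExpr × RingExpr => x.2.1 := Primrec.fst.comp Primrec.snd
  have h22 : Primrec fun x : RingExpr × RingExpr => x.2.2 := Primrec.snd.comp Primrec.snd
  exact (Primrec.list_append.comp (Primrec.mulPos.comp h11 h21) (Primrec.mulPos.comp h12 h22)).pair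
    (Primrec.list_append.comp (Primrec.mulPos.comp h11 h22) (Primrec.mulPos.comp h12 h21))

end Computability

/-! ### Comparing `p`-adic valuations -/

/-- `v_p a ≤ v_p b`, where `v_p 0 = ∞`. -/
def PAdicLE (p : ℕ) (a b : ℤ) : Prop := ∀ e : ℕ, (p : ℤ) ^ e ∣ a → (p : ℤ) ^ e ∣ b

theorem pow_dvd_pow_mul_iff {p : ℕ} (hp : p.Prime) {w : ℤ} (hw : ¬ (p : ℤ) ∣ w) (e k : ℕ) :
    (p : ℤ) ^ e ∣ (p : ℤ) ^ k * w ↔ e ≤ k := by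
  refine ⟨fun h => ?_, fun h => (pow_dvd_pow _ h).mul_right _⟩
  by_contra! hlt
  obtain ⟨c, rfl⟩ := Nat.exists_eq_add_of_lt hlt
  have hp0 : (p : ℤ) ^ k ≠ 0 := pow_ne_zero _ (by exact_mod_cast hp.ne_zero)
  rw [add_assoc, pow_add] at h
  exact hw ((dvd_pow_self _ (Nat.succ_ne_zero c)).trans ((mul_dvd_mul_iff_left hp0).1 h))

theorem pow_dvd_eq_zero {p : ℕ} (hp : 1 < p) {b : ℤ} {e : ℕ} (hb : b.natAbs ≤ e)
    (h : (p : ℤ) ^ e ∣ b) : b = 0 :=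
  Int.eq_zero_of_abs_lt_dvd h (by
    rw [Int.abs_eq_natAbs]
    exact_mod_cast hb.trans_lt (Nat.lt_pow_self hp))

/-- Bounded form of the comparison of valuations, for differences of natural numbers. -/
theorem pAdicLE_sub_iff {p : ℕ} (hp : p.Prime) (A B C D : ℕ) :
    PAdicLE p ((A : ℤ) - B) ((C : ℤ) - D) ↔
      ∀ e < A + B + C + D + 1, A % p ^ e = B % p ^ e → C % p ^ e = D % p ^ e := by
  have key (e A B : ℕ) : A % p ^ e = B % p ^ e ↔ (p : ℤ) ^ e ∣ (A : ℤ) - B := by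
    have := (Nat.modEq_iff_dvd (n := p ^ e) (a := B) (b := A))
    rw [Nat.ModEq, eq_comm] at this
    exact_mod_cast this
  simp only [key]
  refine ⟨fun h e _ => h e, fun h e he => ?_⟩
  by_cases hlt : e < A + B + C + D + 1
  · exact h e hlt he
  -- Beyond the bound, `p ^ e` exceeds `|A - B|`, so `A = B`. The hypothesis at the largest
  -- permitted exponent then already forces `C = D`.
  · have hA := pow_dvd_eq_zero hp.one_lt (by omega) he
    rw [pow_dvd_eq_zero hp.one_lt (by omega) (h (A + B + C + D) (by omega) (by rw [hA]; simp))]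
    simp

/-- The valuation of the value at `p ^ n` of a nonzero polynomial, for large `n`. -/
theorem Polynomial.exists_eval_prime_pow {p : ℕ} (hp : p.Prime) {F : Polynomial ℤ} (hF : F ≠ 0)
    {H : ℕ} (hH : ∀ i, (F.coeff i).natAbs ≤ H) :
    ∃ d a : ℕ, ∀ n : ℕ, H < p ^ n →
      a < n ∧ ∃ w : ℤ, ¬ (p : ℤ) ∣ w ∧ F.eval ((p : ℤ) ^ n) = (p : ℤ) ^ (n * d + a) * w := by
  -- Take `d` to be the trailing degree and `a` the exponent of `p` in the trailing coefficient.
  -- That coefficient is smaller than `p ^ n` in absolute value, so `a < n`, and all higher terms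
  -- have larger valuation.
  obtain ⟨G, hG⟩ : Polynomial.X ^ F.natTrailingDegree ∣ F :=
    Polynomial.X_pow_dvd_iff.2 fun d hd => Polynomial.coeff_eq_zero_of_lt_natTrailingDegree hd
  have hc : G.coeff 0 = F.trailingCoeff := by
    have := congrArg (fun f => Polynomial.coeff f (0 + F.natTrailingDegree)) hG
    simp only [Polynomial.coeff_X_pow_mul] at this
    rw [← this, zero_add, Polynomial.trailingCoeff]
  have hc0 : G.coeff 0 ≠ 0 := by rw [hc]; exact mt Polynomial.trailingCoeff_eq_zero.1 hF
  have hcH : (G.coeff 0).natAbs ≤ H := by rw [hc]; exact hH _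
  have hp' : Prime (p : ℤ) := Nat.prime_iff_prime_int.1 hp
  obtain ⟨a, c, hcn, hca⟩ := WfDvdMonoid.max_power_factor hc0 hp'.irreducible
  refine ⟨F.natTrailingDegree, a, fun n hn => ?_⟩
  have han : a < n := by
    by_contra! hna
    refine hc0 (Int.eq_zero_of_abs_lt_dvd (m := (p : ℤ) ^ n) ?_ ?_)
    · rw [hca]; exact (pow_dvd_pow _ hna).mul_right _
    · rw [Int.abs_eq_natAbs]; exact_mod_cast hcH.trans_lt hn
  obtain ⟨k, rfl⟩ := Nat.exists_eq_add_of_lt han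
  refine ⟨han, c + (p : ℤ) ^ (k + 1) * G.divX.eval ((p : ℤ) ^ (a + k + 1)), fun h => hcn ?_, ?_⟩
  · exact (dvd_add_left ((dvd_pow_self _ (Nat.succ_ne_zero k)).mul_right _)).1 h
  · have hGe : G.eval ((p : ℤ) ^ (a + k + 1)) =
        G.divX.eval ((p : ℤ) ^ (a + k + 1)) * (p : ℤ) ^ (a + k + 1) + G.coeff 0 := by
      conv_lhs => rw [← Polynomial.divX_mul_X_add G]
      simp
    conv_lhs => rw [hG]
    rw [Polynomial.eval_mul, hGe, hca, Polynomial.eval_pow, Polynomial.eval_X]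
    ring

/-- For two polynomials the comparison of the valuations of their values at `p ^ n` does not
depend on `n`, once `p ^ n` exceeds all coefficients. -/
theorem Polynomial.pAdicLE_eval_prime_pow_iff {p : ℕ} (hp : p.Prime) {F G : Polynomial ℤ} {H : ℕ}
    (hF : ∀ i, (F.coeff i).natAbs ≤ H) (hG : ∀ i, (G.coeff i).natAbs ≤ H) {m n : ℕ}
    (hm : H < p ^ m) (hn : H < p ^ n) :
    PAdicLE p (F.eval ((p : ℤ) ^ m)) (G.eval ((p : ℤ) ^ m)) →
      PAdicLE p (F.eval ((p : ℤ) ^ n)) (G.eval ((p : ℤ) ^ n)) := by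
  intro h
  by_cases hG0 : G = 0
  · intro e _; simp [hG0]
  obtain ⟨d', a', hG'⟩ := G.exists_eval_prime_pow hp hG0 hG
  obtain ⟨ha'm, w', hw', hGm⟩ := hG' m hm
  obtain ⟨ha'n, z', hz', hGn⟩ := hG' n hn
  by_cases hF0 : F = 0
  · have := h (m * d' + a' + 1) (by simp [hF0])
    rw [hGm, pow_dvd_pow_mul_iff hp hw'] at this
    omega
  obtain ⟨d, a, hF'⟩ := F.exists_eval_prime_pow hp hF0 hF
  obtain ⟨ham, w, hw, hFm⟩ := hF' m hm
  obtain ⟨han, z, hz, hFn⟩ := hF' n hn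
  have h1 := h (m * d + a) (by rw [hFm]; exact Dvd.intro _ rfl)
  rw [hGm, pow_dvd_pow_mul_iff hp hw'] at h1
  intro e he
  rw [hFn, pow_dvd_pow_mul_iff hp hz] at he
  rw [hGn, pow_dvd_pow_mul_iff hp hz']
  refine he.trans ?_
  -- Since `a` and `a'` are below both `m` and `n`, comparing `n * d + a` with `n * d' + a'` is
  -- comparing `(d, a)` with `(d', a')` lexicographically, whatever `n` is.
  rcases lt_trichotomy d d' with hd | rfl | hd
  · have : n * (d + 1) ≤ n * d' := Nat.mul_le_mul_left n hd
    rw [mul_add] at this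
    omega
  · omega
  · have : m * (d' + 1) ≤ m * d := Nat.mul_le_mul_left m hd
    rw [mul_add] at this
    omega

/-! ### Deciding the comparison of valuations eventually -/

/-- Every index in the list is at most `s`, so each factor is a constant times a power of the
generator `s`. -/
theorem exists_polynomial_evalMonomial (p : ℕ) {s : ℕ} {l : List ℕ} (hl : l.sum ≤ s) :
    ∃ F : Polynomial ℕ, ∀ j, s ≤ j → evalMonomial p l j = F.eval (p ^ stageExponent s j) := by
  induction l with
  | nil => exact ⟨1, fun j _ => by simp [evalMonomial]⟩
  | cons i l ih =>
    rw [List.sum_cons] at hl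
    obtain ⟨F, hF⟩ := ih (by omega)
    obtain ⟨k, m, hkm⟩ := exists_stageExponent_affine (s := i) (s' := s) (by omega)
    refine ⟨Polynomial.C (p ^ k) * Polynomial.X ^ m * F, fun j hj => ?_⟩
    have : evalMonomial p (i :: l) j = p ^ stageExponent i j * evalMonomial p l j := by
      simp [evalMonomial, pow_add]
    rw [this, hF j hj, hkm j hj]
    simp only [Polynomial.eval_mul, Polynomial.eval_C, Polynomial.eval_pow, Polynomial.eval_X]
    ring

/-- A crude bound for the largest generator index occurring: the sum of all of them. -/
def PosExpr.support (P : PosExpr) : ℕ := (P.map fun l => l.sum).sum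

theorem exists_polynomial_evalPos (p : ℕ) {s : ℕ} {P : PosExpr} (hP : PosExpr.support P ≤ s) :
    ∃ F : Polynomial ℕ, ∀ j, s ≤ j → evalPos p P j = F.eval (p ^ stageExponent s j) := by
  induction P with
  | nil => exact ⟨0, fun j _ => by simp [evalPos]⟩
  | cons l P ih =>
    have hP' : l.sum + PosExpr.support P ≤ s := by simpa [PosExpr.support] using hP
    obtain ⟨F, hF⟩ := ih (by omega)
    obtain ⟨G, hG⟩ := exists_polynomial_evalMonomial p (s := s) (l := l) (by omega)
    exact ⟨G + F, fun j hj => by rw [evalPos_cons, hF j hj, hG j hj, Polynomial.eval_add]⟩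

/-- Bounds the unknown coefficients by a value that can be computed from the expression, without
finding the polynomial. -/
theorem Polynomial.coeff_le_eval {F : Polynomial ℕ} {x : ℕ} (hx : 0 < x) (i : ℕ) :
    F.coeff i ≤ F.eval x := by
  rw [Polynomial.eval_eq_sum, Polynomial.sum_def]
  by_cases hi : i ∈ F.support
  · exact (Nat.le_mul_of_pos_right _ (pow_pos hx i)).trans
      (Finset.single_le_sum (f := fun i => F.coeff i * x ^ i) (fun _ _ => Nat.zero_le _) hi)
  · rw [Polynomial.notMem_support_iff.1 hi]; exact Nat.zero_le _

theorem exists_polynomial_evalRing {p : ℕ} (hp : 0 < p) {s : ℕ} {a : RingExpr}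
    (ha : PosExpr.support a.1 + PosExpr.support a.2 ≤ s) :
    ∃ F : Polynomial ℤ, (∀ j, s ≤ j → evalRing p a j = F.eval ((p : ℤ) ^ stageExponent s j)) ∧
      ∀ i, (F.coeff i).natAbs ≤ evalPos p a.1 s + evalPos p a.2 s := by
  obtain ⟨F, hF⟩ := exists_polynomial_evalPos p (s := s) (P := a.1) (by omega)
  obtain ⟨G, hG⟩ := exists_polynomial_evalPos p (s := s) (P := a.2) (by omega)
  have hcast (F : Polynomial ℕ) (x : ℕ) :
      ((F.eval x : ℕ) : ℤ) = (F.map (Nat.castRingHom ℤ)).eval (x : ℤ) := by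
    simp [Polynomial.eval_natCast_map]
  refine ⟨F.map (Nat.castRingHom ℤ) - G.map (Nat.castRingHom ℤ), fun j hj => ?_, fun i => ?_⟩
  · rw [evalRing, hF j hj, hG j hj, hcast, hcast, Polynomial.eval_sub]
    push_cast
    rfl
  · have h1 := F.coeff_le_eval (pow_pos hp (stageExponent s s)) i
    have h2 := G.coeff_le_eval (pow_pos hp (stageExponent s s)) i
    rw [← hF s le_rfl] at h1
    rw [← hG s le_rfl] at h2
    simp only [Polynomial.coeff_sub, Polynomial.coeff_map, Nat.coe_castRingHom]
    omega

def supportBound (x : RingExpr × RingExpr) : ℕ :=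
  PosExpr.support x.1.1 + PosExpr.support x.1.2 + PosExpr.support x.2.1 + PosExpr.support x.2.2

def evalBound (p : ℕ) (x : RingExpr × RingExpr) (j : ℕ) : ℕ :=
  evalPos p x.1.1 j + evalPos p x.1.2 j + evalPos p x.2.1 j + evalPos p x.2.2 j

/-- An index from which on the comparison of two expressions is constant. -/
def stableIndex (p : ℕ) (x : RingExpr × RingExpr) : ℕ :=
  supportBound x + evalBound p x (supportBound x)

/-- Both expressions are polynomials in the generator `s` with coefficients at most `H`. For `j ≥ s
+ H` its exponent is at least `H`, so its value exceeds `H` and the comparison no longer depends on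
`j`. -/
theorem pAdicLE_evalRing_iff {p : ℕ} (hp : p.Prime) (a b : RingExpr) {j : ℕ}
    (hj : stableIndex p (a, b) ≤ j) :
    PAdicLE p (evalRing p a j) (evalRing p b j) ↔
      PAdicLE p (evalRing p a (stableIndex p (a, b))) (evalRing p b (stableIndex p (a, b))) := by
  set s := supportBound (a, b) with hs
  set H := evalBound p (a, b) s with hH
  have hidx : stableIndex p (a, b) = s + H := rfl
  obtain ⟨F, hF, hFc⟩ := exists_polynomial_evalRing hp.pos (s := s) (a := a)
    (by simp only [hs, supportBound]; omega)
  obtain ⟨G, hG, hGc⟩ := exists_polynomial_evalRing hp.pos (s := s) (a := b)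
    (by simp only [hs, supportBound]; omega)
  have hFc' (i) : (F.coeff i).natAbs ≤ H := (hFc i).trans (by simp only [hH, evalBound]; omega)
  have hGc' (i) : (G.coeff i).natAbs ≤ H := (hGc i).trans (by simp only [hH, evalBound]; omega)
  have large (j : ℕ) (hj : s + H ≤ j) : H < p ^ stageExponent s j :=
    ((Nat.le_add_left H s).trans (hj.trans (le_stageExponent (by omega)))).trans_lt
      (Nat.lt_pow_self hp.one_lt)
  rw [hidx] at hj ⊢
  rw [hF j (by omega), hG j (by omega), hF (s + H) (by omega), hG (s + H) (by omega)]
  exact ⟨Polynomial.pAdicLE_eval_prime_pow_iff hp hFc' hGc' (large j hj) (large _ le_rfl),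
    Polynomial.pAdicLE_eval_prime_pow_iff hp hFc' hGc' (large _ le_rfl) (large j hj)⟩

/-- The eventual truth value of `v_p a ≤ v_p b`. -/
def RingExpr.LE (p : ℕ) (x : RingExpr × RingExpr) : Prop :=
  PAdicLE p (evalRing p x.1 (stableIndex p x)) (evalRing p x.2 (stableIndex p x))

theorem PrimrecPred.ringExpr_LE {p : ℕ} (hp : p.Prime) : PrimrecPred (RingExpr.LE p) := by
  have hsup : Primrec PosExpr.support := Primrec.list_sum_map Primrec.id
    ((Primrec.list_sum_map Primrec.snd Primrec₂.right).of_eq fun x => by simp)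
  have h11 : Primrec fun x : RingExpr × RingExpr => x.1.1 := Primrec.fst.comp Primrec.fst
  have h12 : Primrec fun x : RingExpr × RingExpr => x.1.2 := Primrec.snd.comp Primrec.fst
  have h21 : Primrec fun x : RingExpr × RingExpr => x.2.1 := Primrec.fst.comp Primrec.snd
  have h22 : Primrec fun x : RingExpr × RingExpr => x.2.2 := Primrec.snd.comp Primrec.snd
  have hsb : Primrec supportBound :=
    Primrec.nat_add.comp (Primrec.nat_add.comp (Primrec.nat_add.comp (hsup.comp h11)
      (hsup.comp h12)) (hsup.comp h21)) (hsup.comp h22)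
  have he := Primrec.evalPos p
  have heb : Primrec₂ (evalBound p) :=
    Primrec.nat_add.comp (Primrec.nat_add.comp (Primrec.nat_add.comp
      (he.comp (h11.comp Primrec.fst) Primrec.snd) (he.comp (h12.comp Primrec.fst) Primrec.snd))
      (he.comp (h21.comp Primrec.fst) Primrec.snd)) (he.comp (h22.comp Primrec.fst) Primrec.snd)
  have hidx : Primrec (stableIndex p) :=
    Primrec.nat_add.comp hsb (heb.comp Primrec.id hsb)
  let val (x : RingExpr × RingExpr) : (ℕ × ℕ) × (ℕ × ℕ) :=
    ((evalPos p x.1.1 (stableIndex p x), evalPos p x.1.2 (stableIndex p x)),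
      (evalPos p x.2.1 (stableIndex p x), evalPos p x.2.2 (stableIndex p x)))
  have hval : Primrec val :=
    ((he.comp h11 hidx).pair (he.comp h12 hidx)).pair ((he.comp h21 hidx).pair (he.comp h22 hidx))
  let R (e : ℕ) (y : (ℕ × ℕ) × (ℕ × ℕ)) : Prop :=
    ¬ (y.1.1 % p ^ e = y.1.2 % p ^ e) ∨ y.2.1 % p ^ e = y.2.2 % p ^ e
  have hpow : Primrec fun z : ℕ × ((ℕ × ℕ) × (ℕ × ℕ)) => p ^ z.1 :=
    Primrec.nat_pow.comp (Primrec.const p) Primrec.fst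
  have hmod {f : (ℕ × ℕ) × (ℕ × ℕ) → ℕ} (hf : Primrec f) :
      Primrec fun z : ℕ × ((ℕ × ℕ) × (ℕ × ℕ)) => f z.2 % p ^ z.1 :=
    Primrec.nat_mod.comp (hf.comp Primrec.snd) hpow
  have hR1 : PrimrecPred fun z : ℕ × ((ℕ × ℕ) × (ℕ × ℕ)) =>
      z.2.1.1 % p ^ z.1 = z.2.1.2 % p ^ z.1 :=
    Primrec.eq.comp (hmod (f := fun y => y.1.1) (Primrec.fst.comp Primrec.fst))
      (hmod (f := fun y => y.1.2) (Primrec.snd.comp Primrec.fst))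
  have hR2 : PrimrecPred fun z : ℕ × ((ℕ × ℕ) × (ℕ × ℕ)) =>
      z.2.2.1 % p ^ z.1 = z.2.2.2 % p ^ z.1 :=
    Primrec.eq.comp (hmod (f := fun y => y.2.1) (Primrec.fst.comp Primrec.snd))
      (hmod (f := fun y => y.2.2) (Primrec.snd.comp Primrec.snd))
  have hR : PrimrecRel R := (hR1.not.or hR2).primrecRel
  have hbound : Primrec fun x => evalBound p x (stableIndex p x) + 1 :=
    Primrec.succ.comp (heb.comp Primrec.id hidx)
  refine (hR.forall_mem_list.comp (Primrec.list_range.comp hbound) hval).of_eq fun x => ?_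
  rw [RingExpr.LE, evalRing, evalRing, pAdicLE_sub_iff hp]
  simp only [R, val, ← imp_iff_not_or, List.mem_range]
  rfl

/-! ### Computable domains from numberings -/

section Numbering

variable {α A : Type} [Primcodable α] {ν : α → A}

theorem exists_decode_numbering (hν : Function.Surjective ν) (a : A) :
    ∃ n, ∃ x : α, Encodable.decode n = some x ∧ ν x = a := by
  obtain ⟨x, rfl⟩ := hν a
  exact ⟨Encodable.encode x, x, Encodable.encodek x, rfl⟩

open Classical in
/-- The least code of an element with respect to a numbering. -/
noncomputable def leastCode (hν : Function.Surjective ν) (a : A) : ℕ :=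
  Nat.find (exists_decode_numbering hν a)

theorem leastCode_spec (hν : Function.Surjective ν) (a : A) :
    ∃ x : α, Encodable.decode (leastCode hν a) = some x ∧ ν x = a :=
  open Classical in Nat.find_spec (exists_decode_numbering hν a)

theorem leastCode_injective (hν : Function.Surjective ν) :
    Function.Injective (leastCode hν) := by
  intro a b hab
  obtain ⟨x, hx, rfl⟩ := leastCode_spec hν a
  obtain ⟨y, hy, rfl⟩ := leastCode_spec hν b
  rw [hab, hy] at hx
  rw [Option.some_inj.1 hx]

variable {eqv : α → α → Bool}

theorem Computable.leastCode (hν : Function.Surjective ν) (heqv : Computable₂ eqv)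
    (h : ∀ x y, eqv x y = true ↔ ν x = ν y) : Computable fun x => leastCode hν (ν x) := by
  have hpart : Partrec fun x : α => Nat.rfind fun n =>
      Part.some (Option.casesOn (Encodable.decode (α := α) n) false fun y => eqv y x) :=
    Partrec.rfind (Computable.partrec (Computable.option_casesOn
      (Computable.decode.comp Computable.snd) (Computable.const false)
      (heqv.comp Computable.snd (Computable.fst.comp Computable.fst))))
  refine hpart.of_eq_tot fun x => ?_
  have key (n : ℕ) : Option.casesOn (Encodable.decode (α := α) n) false (fun y => eqv y x) = true ↔
      ∃ y : α, Encodable.decode n = some y ∧ ν y = ν x := by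
    cases Encodable.decode (α := α) n <;> simp [h]
  refine Nat.mem_rfind.2 ⟨?_, fun {m} hm => ?_⟩
  · exact Part.mem_some_iff.2 ((key _).2 (leastCode_spec hν (ν x))).symm
  · exact Part.mem_some_iff.2 (Bool.eq_false_iff.2 fun h' =>
      open Classical in Nat.find_min (exists_decode_numbering hν (ν x)) hm ((key _).1 h')).symm

/-- The computable domain of a type numbered with computable equality. -/
noncomputable def ComputableDomain.ofNumbering (hν : Function.Surjective ν)
    (heqv : Computable₂ eqv) (h : ∀ x y, eqv x y = true ↔ ν x = ν y) : ComputableDomain A where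
  code := ⟨leastCode hν, leastCode_injective hν⟩
  computable_range := by
    -- A number is in the range exactly when it decodes and is the least code of the element it
    -- denotes.
    refine ComputablePred.computable_iff.2 ⟨fun n => Option.casesOn (Encodable.decode (α := α) n)
      false fun x => decide (_root_.leastCode hν (ν x) = n), ?_, ?_⟩
    · exact Computable.option_casesOn Computable.decode (Computable.const false)
        ((Primrec.eq.decide.to_comp).comp
          ((Computable.leastCode hν heqv h).comp Computable.snd) Computable.fst)
    · ext n
      simp only [Set.mem_range, Function.Embedding.coeFn_mk]
      constructor
      · rintro ⟨a, rfl⟩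
        obtain ⟨x, hx, hxa⟩ := leastCode_spec hν a
        rw [hx]
        simp [hxa]
      · intro hn
        cases hd : Encodable.decode (α := α) n with
        | none => rw [hd] at hn; simp at hn
        | some x => rw [hd] at hn; exact ⟨ν x, by simpa using hn⟩

/-- A representative of an element given by its code. -/
noncomputable def decodeNumbering [Inhabited α] (n : ℕ) : α :=
  (Encodable.decode n).getD default

theorem Computable.decodeNumbering [Inhabited α] : Computable (decodeNumbering (α := α)) :=
  Computable.option_getD Computable.decode (Computable.const default)

variable (hν : Function.Surjective ν) (heqv : Computable₂ eqv)
  (h : ∀ x y, eqv x y = true ↔ ν x = ν y)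

theorem ComputableDomain.ofNumbering_decode [Inhabited α] (a : A) :
    ν (decodeNumbering ((ComputableDomain.ofNumbering hν heqv h).code a)) = a := by
  obtain ⟨x, hx, hxa⟩ := leastCode_spec hν a
  change ν ((Encodable.decode (leastCode hν a)).getD default) = a
  rw [hx]
  exact hxa

theorem ComputableDomain.ofNumbering_computable :
    Computable fun x => (ComputableDomain.ofNumbering hν heqv h).code (ν x) :=
  Computable.leastCode hν heqv h

theorem ComputableDomain.ofNumbering_computableOp [Inhabited α] {op : A → A → A} {g : α → α → α}
    (hg : Computable₂ g) (hop : ∀ x y, ν (g x y) = op (ν x) (ν y)) :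
    (ComputableDomain.ofNumbering hν heqv h).ComputableOp op :=
  ⟨fun m n => (ComputableDomain.ofNumbering hν heqv h).code
      (ν (g (decodeNumbering m) (decodeNumbering n))),
    (ofNumbering_computable hν heqv h).comp (hg.comp
      (Computable.decodeNumbering.comp Computable.fst)
      (Computable.decodeNumbering.comp Computable.snd)),
    fun x y => by
      beta_reduce
      rw [hop, ofNumbering_decode hν heqv h, ofNumbering_decode hν heqv h]⟩

theorem ComputableDomain.ofNumbering_computableRel [Inhabited α] {r : A → A → Prop}
    {g : α → α → Bool} (hg : Computable₂ g) (hr : ∀ x y, g x y = true ↔ r (ν x) (ν y)) :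
    (ComputableDomain.ofNumbering hν heqv h).ComputableRel r :=
  ⟨fun m n => g (decodeNumbering m) (decodeNumbering n),
    hg.comp (Computable.decodeNumbering.comp Computable.fst)
      (Computable.decodeNumbering.comp Computable.snd),
    fun x y => by
      beta_reduce
      rw [hr, ofNumbering_decode hν heqv h, ofNumbering_decode hν heqv h]⟩

end Numbering

/-! ### Restricting an additive valuation to a subfield -/

section Restrict

variable {F G : Type} [Field F] [AddCommGroup G] [LinearOrder G] [IsOrderedAddMonoid G]
  (w : AddValuation F (WithTop G)) (E : Subfield F)

/-- The values taken by `w` on the nonzero elements of `E`. -/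
def valueSubgroup : AddSubgroup G where
  carrier := {g | ∃ x ∈ E, w x = (g : WithTop G)}
  zero_mem' := ⟨1, E.one_mem, w.map_one⟩
  add_mem' := by
    rintro g h ⟨x, hx, hg⟩ ⟨y, hy, hh⟩
    exact ⟨x * y, E.mul_mem hx hy, by rw [w.map_mul, hg, hh, WithTop.coe_add]⟩
  neg_mem' := by
    rintro g ⟨x, hx, hg⟩
    refine ⟨x⁻¹, E.inv_mem hx, ?_⟩
    have hx0 : x ≠ 0 := by
      rintro rfl
      rw [w.map_zero] at hg
      exact WithTop.top_ne_coe hg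
    have h1 : w x + w x⁻¹ = 0 := by rw [← w.map_mul, mul_inv_cancel₀ hx0, w.map_one]
    have h2 : w x⁻¹ ≠ ⊤ := by
      intro h
      rw [h, WithTop.add_top] at h1
      exact WithTop.top_ne_zero h1
    obtain ⟨k, hk⟩ := WithTop.ne_top_iff_exists.1 h2
    rw [hg, ← hk, ← WithTop.coe_add, ← WithTop.coe_zero, WithTop.coe_inj] at h1
    rw [← hk, eq_neg_of_add_eq_zero_right h1]

theorem exists_restrictVal (x : E) :
    ∃ g : WithTop (valueSubgroup w E), g.map ((↑) : valueSubgroup w E → G) = w x := by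
  rcases h : w x with _ | g
  · exact ⟨⊤, rfl⟩
  · exact ⟨((⟨g, x, x.2, h⟩ : valueSubgroup w E) : WithTop _), rfl⟩

noncomputable def restrictValFun (x : E) : WithTop (valueSubgroup w E) :=
  (exists_restrictVal w E x).choose

theorem map_restrictValFun (x : E) :
    (restrictValFun w E x).map ((↑) : valueSubgroup w E → G) = w x :=
  (exists_restrictVal w E x).choose_spec

theorem withTop_map_coe_injective :
    Function.Injective (WithTop.map ((↑) : valueSubgroup w E → G)) :=
  WithTop.map_injective Subtype.val_injective

theorem withTop_map_coe_le {a b : WithTop (valueSubgroup w E)} :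
    a.map ((↑) : valueSubgroup w E → G) ≤ b.map (↑) ↔ a ≤ b :=
  WithTop.map_le_iff _ Iff.rfl

/-- The restriction of `w` to `E`, with values in the group of its values. -/
noncomputable def restrictVal : AddValuation E (WithTop (valueSubgroup w E)) :=
  AddValuation.of (restrictValFun w E)
    (withTop_map_coe_injective w E (by rw [map_restrictValFun]; exact w.map_zero))
    (withTop_map_coe_injective w E (by rw [map_restrictValFun]; exact w.map_one))
    (fun x y => by
      have h := w.map_add x y
      rw [min_le_iff, ← map_restrictValFun, ← map_restrictValFun] at h
      change _ ≤ w ((x + y : E) : F) ∨ _ ≤ w ((x + y : E) : F) at h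
      rw [← map_restrictValFun, withTop_map_coe_le, withTop_map_coe_le] at h
      exact min_le_iff.2 h)
    (fun x y => withTop_map_coe_injective w E (by
      have := WithTop.map_add (valueSubgroup w E).subtype (restrictValFun w E x)
        (restrictValFun w E y)
      rw [map_restrictValFun]
      refine (w.map_mul x y).trans ?_
      rw [← map_restrictValFun, ← map_restrictValFun]
      exact this.symm))

theorem map_restrictVal (x : E) :
    (restrictVal w E x).map ((↑) : valueSubgroup w E → G) = w x :=
  map_restrictValFun w E x

theorem restrictVal_le_iff (x y : E) : restrictVal w E x ≤ restrictVal w E y ↔ w x ≤ w y := by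
  rw [← map_restrictVal, ← map_restrictVal, withTop_map_coe_le]

theorem restrictVal_eq_coe_iff (x : E) (g : valueSubgroup w E) :
    restrictVal w E x = (g : WithTop _) ↔ w x = ((g : G) : WithTop G) := by
  rw [← map_restrictVal, ← (withTop_map_coe_injective w E).eq_iff, WithTop.map_coe]

theorem restrictVal_surjective : Function.Surjective (restrictVal w E) := by
  intro g
  cases g with
  | top => exact ⟨0, (restrictVal w E).map_zero⟩
  | coe g =>
    obtain ⟨x, hx, hg⟩ := g.2
    exact ⟨⟨x, hx⟩, (restrictVal_eq_coe_iff w E _ _).2 hg⟩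

end Restrict

/-! ### The `p`-adic valuation on an ultrapower of `ℚ` -/

open Filter

/-- The ultrapower of `ℚ`. -/
abbrev RatGerm : Type := Germ (hyperfilter ℕ : Filter ℕ) ℚ

/-- The ultrapower of `ℤ`. -/
abbrev IntGerm : Type := Germ (hyperfilter ℕ : Filter ℕ) ℤ

/-- The germ of a sequence of rational numbers. -/
noncomputable def ratGerm : (ℕ → ℚ) →+* RatGerm := Germ.coeRingHom _

noncomputable def intGerm : (ℕ → ℤ) →+* IntGerm := Germ.coeRingHom _

theorem ratGerm_surjective : Function.Surjective ratGerm := fun x =>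
  Germ.inductionOn x fun f => ⟨f, rfl⟩

theorem intGerm_surjective : Function.Surjective intGerm := fun x =>
  Germ.inductionOn x fun f => ⟨f, rfl⟩

theorem ratGerm_eq_iff {f g : ℕ → ℚ} :
    ratGerm f = ratGerm g ↔ ∀ᶠ j in (hyperfilter ℕ : Filter ℕ), f j = g j := Germ.coe_eq

theorem intGerm_eq_iff {f g : ℕ → ℤ} :
    intGerm f = intGerm g ↔ ∀ᶠ j in (hyperfilter ℕ : Filter ℕ), f j = g j := Germ.coe_eq

theorem intGerm_le_iff {f g : ℕ → ℤ} :
    intGerm f ≤ intGerm g ↔ ∀ᶠ j in (hyperfilter ℕ : Filter ℕ), f j ≤ g j := Germ.coe_le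

theorem intGerm_lt_iff {f g : ℕ → ℤ} :
    intGerm f < intGerm g ↔ ∀ᶠ j in (hyperfilter ℕ : Filter ℕ), f j < g j := Germ.coe_lt

theorem ratGerm_eq_zero_iff {f : ℕ → ℚ} :
    ratGerm f = 0 ↔ ∀ᶠ j in (hyperfilter ℕ : Filter ℕ), f j = 0 := by
  rw [← map_zero ratGerm, ratGerm_eq_iff]
  rfl

theorem ratGerm_ne_zero_iff {f : ℕ → ℚ} :
    ratGerm f ≠ 0 ↔ ∀ᶠ j in (hyperfilter ℕ : Filter ℕ), f j ≠ 0 := by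
  rw [Ne, ratGerm_eq_zero_iff, Ultrafilter.eventually_not]

instance : CharZero RatGerm :=
  charZero_of_injective_ringHom (ratGerm.comp (Pi.constRingHom ℕ ℚ)).injective

theorem ratGerm_const (q : ℚ) : ratGerm (fun _ => q) = (q : RatGerm) :=
  map_ratCast (ratGerm.comp (Pi.constRingHom ℕ ℚ)) q

theorem eventually_hyperfilter_of_le {P : ℕ → Prop} (n : ℕ) (h : ∀ j, n ≤ j → P j) :
    ∀ᶠ j in (hyperfilter ℕ : Filter ℕ), P j :=
  (Nat.hyperfilter_le_atTop) ((eventually_ge_atTop n).mono h)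

section Valuation

variable (p : ℕ)

/-- The pointwise `p`-adic value of a germ. -/
noncomputable def germVal (x : RatGerm) : IntGerm := Germ.map (padicValRat p) x

theorem germVal_ratGerm (f : ℕ → ℚ) :
    germVal p (ratGerm f) = intGerm fun j => padicValRat p (f j) := rfl

variable [hp : Fact p.Prime]

open Classical in
/-- The `p`-adic valuation on the ultrapower of `ℚ`. -/
noncomputable def germValuation : AddValuation RatGerm (WithTop IntGerm) :=
  AddValuation.of (fun x => if x = 0 then ⊤ else (germVal p x : WithTop IntGerm))
    (if_pos rfl)
    (by
      rw [if_neg one_ne_zero, ← map_one ratGerm, germVal_ratGerm]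
      have : (intGerm fun j => padicValRat p ((1 : ℕ → ℚ) j)) = 0 := by
        rw [← map_zero intGerm]
        congr 1
        ext j
        simp
      rw [this]
      rfl)
    (fun x y => by
      by_cases hxy : x + y = 0
      · simp [hxy]
      by_cases hx : x = 0
      · simp [hx]
      by_cases hy : y = 0
      · simp [hy]
      rw [if_neg hx, if_neg hy, if_neg hxy, min_le_iff, WithTop.coe_le_coe, WithTop.coe_le_coe]
      obtain ⟨f, rfl⟩ := ratGerm_surjective x
      obtain ⟨g, rfl⟩ := ratGerm_surjective y
      rw [← map_add] at hxy ⊢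
      rw [germVal_ratGerm, germVal_ratGerm, germVal_ratGerm, intGerm_le_iff, intGerm_le_iff,
        ← Ultrafilter.eventually_or]
      filter_upwards [ratGerm_ne_zero_iff.1 hxy] with j hj
      exact min_le_iff.1 (padicValRat.min_le_padicValRat_add hj))
    (fun x y => by
      by_cases hx : x = 0
      · simp [hx]
      by_cases hy : y = 0
      · simp [hy]
      rw [if_neg hx, if_neg hy, if_neg (mul_ne_zero hx hy), ← WithTop.coe_add, WithTop.coe_inj]
      obtain ⟨f, rfl⟩ := ratGerm_surjective x
      obtain ⟨g, rfl⟩ := ratGerm_surjective y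
      rw [← map_mul, germVal_ratGerm, germVal_ratGerm, germVal_ratGerm, ← map_add, intGerm_eq_iff]
      filter_upwards [ratGerm_ne_zero_iff.1 hx, ratGerm_ne_zero_iff.1 hy] with j h1 h2
      exact padicValRat.mul h1 h2)

theorem germValuation_of_ne_zero {x : RatGerm} (hx : x ≠ 0) :
    germValuation p x = (germVal p x : WithTop IntGerm) := if_neg hx

theorem germValuation_eq_top_iff {x : RatGerm} : germValuation p x = ⊤ ↔ x = 0 :=
  AddValuation.top_iff _

theorem germValuation_le_iff (x y : RatGerm) :
    germValuation p x ≤ germValuation p y ↔ y = 0 ∨ x ≠ 0 ∧ germVal p x ≤ germVal p y := by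
  by_cases hy : y = 0
  · simp [hy]
  by_cases hx : x = 0
  · simp [hx, hy]
  · simp [hx, hy, germValuation_of_ne_zero]

/-- The separate clauses for `0` are needed because `padicValRat` takes the value `0` there, not
infinity. -/
theorem pAdicLE_iff (a b : ℤ) :
    PAdicLE p a b ↔ b = 0 ∨ a ≠ 0 ∧ padicValRat p (a : ℚ) ≤ padicValRat p (b : ℚ) := by
  simp only [PAdicLE, padicValInt_dvd_iff, padicValRat.of_int, Nat.cast_le]
  constructor
  · intro h
    by_cases ha : a = 0
    · have := h (padicValInt p b + 1) (Or.inl ha)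
      left
      exact this.resolve_right (by omega)
    · exact (h (padicValInt p a) (Or.inr le_rfl)).imp id fun h => ⟨ha, h⟩
  · rintro (h | ⟨ha, h⟩) e he
    · exact Or.inl h
    · exact Or.inr ((he.resolve_left ha).trans h)

theorem germValuation_intCast_le_iff (f g : ℕ → ℤ) :
    germValuation p (ratGerm fun j => (f j : ℚ)) ≤ germValuation p (ratGerm fun j => (g j : ℚ)) ↔
      ∀ᶠ j in (hyperfilter ℕ : Filter ℕ), PAdicLE p (f j) (g j) := by
  simp only [pAdicLE_iff, germValuation_le_iff, Ultrafilter.eventually_or, eventually_and,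
    germVal_ratGerm, intGerm_le_iff, ratGerm_eq_zero_iff, Int.cast_eq_zero, Ne,
    Ultrafilter.eventually_not]

theorem germValuation_div_le_div_iff {a b c d : RatGerm} (hb : b ≠ 0) (hd : d ≠ 0) :
    germValuation p (a / b) ≤ germValuation p (c / d) ↔
      germValuation p (a * d) ≤ germValuation p (c * b) := by
  have h1 : a * d = a / b * (b * d) := by field_simp
  have h2 : c * b = c / d * (b * d) := by field_simp
  rw [h1, h2, AddValuation.map_mul _ (a / b), AddValuation.map_mul _ (c / d)]
  exact (WithTop.add_le_add_iff_right
    (mt (germValuation_eq_top_iff p).1 (mul_ne_zero hb hd))).symm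

theorem padicValRat_pos_iff_norm_lt_one {q : ℚ} (hq : q ≠ 0) :
    0 < padicValRat p q ↔ ‖(q : ℚ_[p])‖ < 1 := by
  rw [Padic.eq_padicNorm, padicNorm, if_neg hq, ← Rat.cast_one, Rat.cast_lt,
    zpow_lt_one_iff_right₀ (by exact_mod_cast hp.out.one_lt)]
  omega

theorem norm_le_one_of_padicValRat_nonneg {q : ℚ} (hq : 0 ≤ padicValRat p q) :
    ‖(q : ℚ_[p])‖ ≤ 1 := by
  by_cases h0 : q = 0
  · simp [h0]
  rw [Padic.eq_padicNorm, padicNorm, if_neg h0, ← Rat.cast_one, Rat.cast_le,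
    zpow_le_one_iff_right₀ (by exact_mod_cast hp.out.one_lt)]
  omega

theorem exists_residue_padicValRat {q : ℚ} (hq : 0 ≤ padicValRat p q) :
    ∃ c ∈ Finset.range p, q - (c : ℕ) = 0 ∨ 0 < padicValRat p (q - (c : ℕ)) := by
  obtain ⟨n, hn0, hnp, hn⟩ := PadicInt.exists_mem_range_of_norm_rat_le_one q
    (norm_le_one_of_padicValRat_nonneg p hq)
  lift n to ℕ using hn0
  refine ⟨n, Finset.mem_range.2 (by exact_mod_cast hnp), or_iff_not_imp_left.2 fun h0 => ?_⟩
  rw [padicValRat_pos_iff_norm_lt_one p h0]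
  have hn' : ‖(q : ℚ_[p]) - (((n : ℤ) : ℤ_[p]) : ℚ_[p])‖ < 1 := hn
  rw [Rat.cast_sub, Rat.cast_natCast]
  simpa only [PadicInt.coe_natCast, Int.cast_natCast] using hn'

/-- Turns pointwise residues in `{0, ..., p - 1}` into one residue valid for the whole germ. -/
theorem Ultrafilter.eventually_exists_mem_finset {ι α : Type*} (u : Ultrafilter α)
    (s : Finset ι) {P : ι → α → Prop} (h : ∀ᶠ x in (u : Filter α), ∃ i ∈ s, P i x) :
    ∃ i ∈ s, ∀ᶠ x in (u : Filter α), P i x := by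
  classical
  induction s using Finset.induction_on with
  | empty =>
    obtain ⟨_, _, hi, _⟩ := h.exists
    exact absurd hi (Finset.notMem_empty _)
  | insert a s _ ih =>
    simp only [Finset.mem_insert, exists_eq_or_imp, Ultrafilter.eventually_or] at h ⊢
    exact h.imp id ih

/-- Every integral germ is congruent to a natural number. -/
theorem exists_residue_germ {x : RatGerm} (hx : 0 ≤ germValuation p x) :
    ∃ c : ℕ, 0 < germValuation p (x - c) := by
  by_cases hx0 : x = 0
  · exact ⟨0, by simp [hx0]⟩
  obtain ⟨f, rfl⟩ := ratGerm_surjective x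
  rw [germValuation_of_ne_zero p hx0, germVal_ratGerm, ← WithTop.coe_zero, WithTop.coe_le_coe,
    ← map_zero intGerm, intGerm_le_iff] at hx
  obtain ⟨c, -, hc⟩ := Ultrafilter.eventually_exists_mem_finset _ _
    (hx.mono fun j hj => exists_residue_padicValRat p hj)
  refine ⟨c, ?_⟩
  have hsub : ratGerm f - c = ratGerm fun j => f j - (c : ℕ) := by
    have : (c : RatGerm) = ratGerm fun _ => (c : ℚ) := by rw [ratGerm_const]; norm_cast
    rw [this, ← map_sub]
    rfl
  rw [hsub]
  by_cases h0 : ratGerm (fun j => f j - (c : ℕ)) = 0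
  · rw [h0, AddValuation.map_zero]
    exact WithTop.coe_lt_top _
  rw [germValuation_of_ne_zero p h0, germVal_ratGerm, ← WithTop.coe_zero, WithTop.coe_lt_coe,
    ← map_zero intGerm, intGerm_lt_iff]
  filter_upwards [hc, ratGerm_ne_zero_iff.1 h0] with j h1 h2
  exact h1.resolve_left h2

end Valuation

/-! ### Subfields of the ultrapower are formally `p`-adic -/

section FormallyPAdic

theorem mem_valRing_iff {K Γ : Type} [Field K] [AddCommGroup Γ] [LinearOrder Γ]
    [IsOrderedAddMonoid Γ] (v : AddValuation K (WithTop Γ)) (x : K) :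
    x ∈ valRing v ↔ 0 ≤ v x := Iff.rfl

theorem residue_eq_zero_of_pos {K Γ : Type} [Field K] [AddCommGroup Γ] [LinearOrder Γ]
    [IsOrderedAddMonoid Γ] (v : AddValuation K (WithTop Γ)) {x : valRing v}
    (hx : 0 < v (x : K)) : IsLocalRing.residue (valRing v) x = 0 := by
  rw [IsLocalRing.residue_eq_zero_iff, IsLocalRing.mem_maximalIdeal, mem_nonunits_iff]
  intro hu
  obtain ⟨y, hy⟩ := hu.exists_right_inv
  have hxy : v (x : K) + v (y : K) = 0 := by
    have : (x : K) * (y : K) = 1 := congrArg Subtype.val hy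
    rw [← v.map_mul, this, v.map_one]
  have hy0 : 0 ≤ v (y : K) := (mem_valRing_iff v _).1 y.2
  exact absurd hxy (add_pos_of_pos_of_nonneg hx hy0).ne'

/-- If every integral element is congruent to a natural number, then the residue field is `𝔽_p`. -/
theorem nonempty_residueField_equiv {K Γ : Type} [Field K] [AddCommGroup Γ] [LinearOrder Γ]
    [IsOrderedAddMonoid Γ] (v : AddValuation K (WithTop Γ)) {p : ℕ} (hp : p.Prime)
    (hvp : 0 < v (p : K)) (h : ∀ x : K, 0 ≤ v x → ∃ c : ℕ, 0 < v (x - c)) :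
    Nonempty (IsLocalRing.ResidueField (valRing v) ≃+* ZMod p) := by
  have hchar : CharP (IsLocalRing.ResidueField (valRing v)) p := by
    rw [CharP.charP_iff_prime_eq_zero hp, ← map_natCast (IsLocalRing.residue (valRing v))]
    exact residue_eq_zero_of_pos v hvp
  have : Fact p.Prime := ⟨hp⟩
  refine ⟨(RingEquiv.ofBijective (ZMod.castHom dvd_rfl (IsLocalRing.ResidueField (valRing v)))
    ⟨RingHom.injective _, fun y => ?_⟩).symm⟩
  obtain ⟨x, rfl⟩ := IsLocalRing.residue_surjective y
  obtain ⟨c, hc⟩ := h x ((mem_valRing_iff v _).1 x.2)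
  refine ⟨c, ?_⟩
  rw [map_natCast, ← map_natCast (IsLocalRing.residue (valRing v)), eq_comm, ← sub_eq_zero,
    ← map_sub]
  exact residue_eq_zero_of_pos v hc

variable (p : ℕ) [hp : Fact p.Prime] (E : Subfield RatGerm)

theorem intGerm_const_smul (n : ℤ) : n • (1 : IntGerm) = intGerm fun _ => n := by
  rw [zsmul_one, eq_comm]
  exact map_intCast (intGerm.comp (Pi.constRingHom ℕ ℤ)) n

theorem germValuation_ratCast {q : ℚ} (hq : q ≠ 0) :
    germValuation p (q : RatGerm) = ((padicValRat p q • (1 : IntGerm) : IntGerm) : WithTop IntGerm) := by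
  rw [germValuation_of_ne_zero p (Rat.cast_ne_zero.2 hq), ← ratGerm_const, germVal_ratGerm,
    intGerm_const_smul]

theorem germValuation_prime : germValuation p (p : RatGerm) = ((1 : IntGerm) : WithTop IntGerm) := by
  have := germValuation_ratCast p (q := p) (by exact_mod_cast hp.out.ne_zero)
  simpa [padicValRat.self hp.out.one_lt] using this

/-- Every subfield contains `p` and the natural numbers, which represent all residues; and `1`, the
least positive element of the ultrapower of `ℤ`, stays least in a subgroup containing it. -/
theorem isFormallyPAdic_restrictVal : IsFormallyPAdic p (restrictVal (germValuation p) E) := by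
  set v := restrictVal (germValuation p) E with hv
  have hmem : (1 : IntGerm) ∈ valueSubgroup (germValuation p) E :=
    ⟨p, natCast_mem E p, germValuation_prime p⟩
  have hvp : v (p : E) = ((⟨1, hmem⟩ : valueSubgroup (germValuation p) E) : WithTop _) :=
    (restrictVal_eq_coe_iff _ _ _ _).2 (by
      push_cast
      exact germValuation_prime p)
  have hpos (x : E) : 0 < v x ↔ 0 < germValuation p x := by
    rw [← v.map_one, ← (germValuation p).map_one, ← not_le, ← not_le, restrictVal_le_iff]
    rfl
  have hnonneg (x : E) : 0 ≤ v x ↔ 0 ≤ germValuation p x := by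
    rw [← v.map_one, ← (germValuation p).map_one, restrictVal_le_iff]
    rfl
  refine ⟨inferInstance, ⟨1, hmem⟩, fun q hq => ?_, ?_, hvp, ?_, ?_⟩
  · exact (restrictVal_eq_coe_iff _ _ _ _).2 (germValuation_ratCast p hq)
  · refine nonempty_residueField_equiv v hp.out ?_ fun x hx => ?_
    · rw [hpos]
      push_cast
      rw [germValuation_prime, ← WithTop.coe_zero, WithTop.coe_lt_coe]
      exact one_pos
    · obtain ⟨c, hc⟩ := exists_residue_germ p ((hnonneg x).1 hx)
      exact ⟨c, (hpos _).2 (by push_cast; exact hc)⟩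
  · exact (one_pos : (0 : IntGerm) < 1)
  · rintro ⟨g, hg⟩ h0
    obtain ⟨f, rfl⟩ := intGerm_surjective g
    have h0' : intGerm 0 < intGerm f := by rw [map_zero]; exact h0
    change (1 : IntGerm) ≤ intGerm f
    rw [← map_one intGerm]
    rw [intGerm_lt_iff] at h0'
    rw [intGerm_le_iff]
    -- Over `ℤ`, pointwise `0 < f j` is by definition `1 ≤ f j`.
    exact h0'

end FormallyPAdic

/-! ### The field of quotients of expressions in the generators -/

/-- Formal quotients of expressions. -/
abbrev FieldExpr := RingExpr × RingExpr

def RingExpr.zero : RingExpr := ([], [])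

def RingExpr.one : RingExpr := ([[]], [])

section

variable (p : ℕ)

noncomputable def ringGerm (a : RingExpr) : RatGerm := ratGerm fun j => (evalRing p a j : ℚ)

theorem ringGerm_add (a b : RingExpr) : ringGerm p (a.add b) = ringGerm p a + ringGerm p b := by
  simp only [ringGerm, ← map_add, evalRing_add, Int.cast_add]
  rfl

theorem ringGerm_mul (a b : RingExpr) : ringGerm p (a.mul b) = ringGerm p a * ringGerm p b := by
  simp only [ringGerm, ← map_mul, evalRing_mul, Int.cast_mul]
  rfl

theorem ringGerm_swap (a : RingExpr) : ringGerm p a.swap = -ringGerm p a := by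
  simp only [ringGerm, ← map_neg, evalRing_swap, Int.cast_neg]
  rfl

theorem ringGerm_zero : ringGerm p RingExpr.zero = 0 := by
  simp only [ringGerm, ← map_zero ratGerm, evalRing, RingExpr.zero, evalPos]
  congr 1

theorem ringGerm_one : ringGerm p RingExpr.one = 1 := by
  simp only [ringGerm, ← map_one ratGerm, evalRing, RingExpr.one, evalPos, evalMonomial]
  congr 1

/-- The expression consisting of a single generator. -/
def RingExpr.generator (s : ℕ) : RingExpr := ([[s]], [])

theorem ringGerm_generator (s : ℕ) :
    ringGerm p (RingExpr.generator s) = ratGerm fun j => (p : ℚ) ^ stageExponent s j := by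
  simp only [ringGerm, evalRing, RingExpr.generator, evalPos, evalMonomial]
  congr 1
  ext j
  simp

variable [hp : Fact p.Prime]

/-- The comparison is constant from `stableIndex` on, so the nonconstructive ultrafilter has no
influence on it. -/
theorem germValuation_ringGerm_le_iff (a b : RingExpr) :
    germValuation p (ringGerm p a) ≤ germValuation p (ringGerm p b) ↔ RingExpr.LE p (a, b) := by
  rw [ringGerm, ringGerm, germValuation_intCast_le_iff]
  constructor
  · intro h
    obtain ⟨j, h1, h2⟩ :=
      (h.and (eventually_hyperfilter_of_le (stableIndex p (a, b)) fun j hj => hj)).exists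
    exact (pAdicLE_evalRing_iff hp.out a b h2).1 h1
  · exact fun h => eventually_hyperfilter_of_le _
      fun j hj => (pAdicLE_evalRing_iff hp.out a b hj).2 h

/-- Equality is decided through the valuation: only `0` has value at least `∞`. -/
theorem ringGerm_eq_zero_iff (a : RingExpr) :
    ringGerm p a = 0 ↔ RingExpr.LE p (RingExpr.zero, a) := by
  rw [← germValuation_ringGerm_le_iff, ringGerm_zero, AddValuation.map_zero, top_le_iff,
    germValuation_eq_top_iff]

open Classical in
/-- Replaces a vanishing denominator by `1`. -/
noncomputable def FieldExpr.normalize (x : FieldExpr) : FieldExpr :=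
  if RingExpr.LE p (RingExpr.zero, x.2) then (x.1, RingExpr.one) else x

open Classical in
theorem Primrec.fieldExpr_normalize : Primrec (FieldExpr.normalize p) :=
  Primrec.ite ((PrimrecPred.ringExpr_LE hp.out).comp ((Primrec.const RingExpr.zero).pair Primrec.snd))
    (Primrec.fst.pair (Primrec.const RingExpr.one)) Primrec.id

theorem ringGerm_normalize_ne_zero (x : FieldExpr) :
    ringGerm p (FieldExpr.normalize p x).2 ≠ 0 := by
  unfold FieldExpr.normalize
  split_ifs with h
  · rw [ringGerm_one]; exact one_ne_zero
  · exact mt (ringGerm_eq_zero_iff p _).1 h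

/-- The germ denoted by a formal quotient. -/
noncomputable def fieldGerm (x : FieldExpr) : RatGerm :=
  ringGerm p (FieldExpr.normalize p x).1 / ringGerm p (FieldExpr.normalize p x).2

theorem fieldGerm_mk {a b : RingExpr} (hb : ringGerm p b ≠ 0) :
    fieldGerm p (a, b) = ringGerm p a / ringGerm p b := by
  have : FieldExpr.normalize p (a, b) = (a, b) := if_neg (mt (ringGerm_eq_zero_iff p _).2 hb)
  rw [fieldGerm, this]

theorem fieldGerm_mk_one (a : RingExpr) : fieldGerm p (a, RingExpr.one) = ringGerm p a := by
  rw [fieldGerm_mk p (by rw [ringGerm_one]; exact one_ne_zero), ringGerm_one, div_one]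

noncomputable def FieldExpr.add (x y : FieldExpr) : FieldExpr :=
  (((normalize p x).1.mul (normalize p y).2).add ((normalize p x).2.mul (normalize p y).1),
    (normalize p x).2.mul (normalize p y).2)

noncomputable def FieldExpr.mul (x y : FieldExpr) : FieldExpr :=
  ((normalize p x).1.mul (normalize p y).1, (normalize p x).2.mul (normalize p y).2)

noncomputable def FieldExpr.neg (x : FieldExpr) : FieldExpr :=
  ((normalize p x).1.swap, (normalize p x).2)

theorem fieldGerm_add (x y : FieldExpr) :
    fieldGerm p (FieldExpr.add p x y) = fieldGerm p x + fieldGerm p y := by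
  have hx := ringGerm_normalize_ne_zero p x
  have hy := ringGerm_normalize_ne_zero p y
  rw [FieldExpr.add, fieldGerm_mk p (by rw [ringGerm_mul]; exact mul_ne_zero hx hy), ringGerm_add,
    ringGerm_mul, ringGerm_mul, ringGerm_mul, fieldGerm, fieldGerm, div_add_div _ _ hx hy]

theorem fieldGerm_mul (x y : FieldExpr) :
    fieldGerm p (FieldExpr.mul p x y) = fieldGerm p x * fieldGerm p y := by
  have hx := ringGerm_normalize_ne_zero p x
  have hy := ringGerm_normalize_ne_zero p y
  rw [FieldExpr.mul, fieldGerm_mk p (by rw [ringGerm_mul]; exact mul_ne_zero hx hy), ringGerm_mul,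
    ringGerm_mul, fieldGerm, fieldGerm, div_mul_div_comm]

theorem fieldGerm_neg (x : FieldExpr) : fieldGerm p (FieldExpr.neg p x) = -fieldGerm p x := by
  rw [FieldExpr.neg, fieldGerm_mk p (ringGerm_normalize_ne_zero p x), ringGerm_swap, fieldGerm,
    neg_div]

/-- The field generated by the germs of the sequences `p ^ stageExponent s j`. -/
noncomputable def germField : Subfield RatGerm where
  carrier := Set.range (fieldGerm p)
  zero_mem' := ⟨(RingExpr.zero, RingExpr.one), by rw [fieldGerm_mk_one, ringGerm_zero]⟩
  one_mem' := ⟨(RingExpr.one, RingExpr.one), by rw [fieldGerm_mk_one, ringGerm_one]⟩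
  add_mem' := by
    rintro _ _ ⟨x, rfl⟩ ⟨y, rfl⟩
    exact ⟨_, fieldGerm_add p x y⟩
  mul_mem' := by
    rintro _ _ ⟨x, rfl⟩ ⟨y, rfl⟩
    exact ⟨_, fieldGerm_mul p x y⟩
  neg_mem' := by
    rintro _ ⟨x, rfl⟩
    exact ⟨_, fieldGerm_neg p x⟩
  inv_mem' := by
    rintro _ ⟨x, rfl⟩
    by_cases h : ringGerm p (FieldExpr.normalize p x).1 = 0
    · exact ⟨x, by rw [fieldGerm, h, zero_div, inv_zero]⟩
    · exact ⟨(FieldExpr.normalize p x).swap, by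
        rw [Prod.swap, fieldGerm_mk p h, fieldGerm, inv_div]⟩

/-- The numbering of `germField` by formal quotients. -/
noncomputable def germFieldNumbering (x : FieldExpr) : germField p := ⟨fieldGerm p x, x, rfl⟩

theorem germFieldNumbering_surjective : Function.Surjective (germFieldNumbering p) := by
  rintro ⟨_, x, rfl⟩
  exact ⟨x, rfl⟩

theorem germFieldNumbering_add (x y : FieldExpr) : germFieldNumbering p (FieldExpr.add p x y) =
    germFieldNumbering p x + germFieldNumbering p y := Subtype.ext (fieldGerm_add p x y)

theorem germFieldNumbering_mul (x y : FieldExpr) : germFieldNumbering p (FieldExpr.mul p x y) =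
    germFieldNumbering p x * germFieldNumbering p y := Subtype.ext (fieldGerm_mul p x y)

theorem germFieldNumbering_neg (x : FieldExpr) : germFieldNumbering p (FieldExpr.neg p x) =
    -germFieldNumbering p x := Subtype.ext (fieldGerm_neg p x)

theorem Primrec.fieldExpr_add : Primrec₂ (FieldExpr.add p) := by
  have hx := (Primrec.fieldExpr_normalize p).comp (Primrec.fst (α := FieldExpr) (β := FieldExpr))
  have hy := (Primrec.fieldExpr_normalize p).comp (Primrec.snd (α := FieldExpr) (β := FieldExpr))
  have hm := Primrec.ringExpr_mul
  exact (Primrec.ringExpr_add.comp (hm.comp (Primrec.fst.comp hx) (Primrec.snd.comp hy))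
    (hm.comp (Primrec.snd.comp hx) (Primrec.fst.comp hy))).pair
      (hm.comp (Primrec.snd.comp hx) (Primrec.snd.comp hy))

theorem Primrec.fieldExpr_mul : Primrec₂ (FieldExpr.mul p) := by
  have hx := (Primrec.fieldExpr_normalize p).comp (Primrec.fst (α := FieldExpr) (β := FieldExpr))
  have hy := (Primrec.fieldExpr_normalize p).comp (Primrec.snd (α := FieldExpr) (β := FieldExpr))
  have hm := Primrec.ringExpr_mul
  exact (hm.comp (Primrec.fst.comp hx) (Primrec.fst.comp hy)).pair
      (hm.comp (Primrec.snd.comp hx) (Primrec.snd.comp hy))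

theorem Primrec.fieldExpr_neg : Primrec (FieldExpr.neg p) := by
  have hx := Primrec.fieldExpr_normalize p
  exact ((Primrec.snd.comp (Primrec.fst.comp hx)).pair (Primrec.fst.comp (Primrec.fst.comp hx))).pair
    (Primrec.snd.comp hx)

/-- The valuation of `germField`. -/
noncomputable abbrev germFieldVal :
    AddValuation (germField p) (WithTop (valueSubgroup (germValuation p) (germField p))) :=
  restrictVal (germValuation p) (germField p)

/-- Comparison of the values of formal quotients. -/
def FieldExpr.LE (x y : FieldExpr) : Prop :=
  RingExpr.LE p ((normalize p x).1.mul (normalize p y).2, (normalize p y).1.mul (normalize p x).2)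

theorem germFieldVal_le_iff (x y : FieldExpr) :
    germFieldVal p (germFieldNumbering p x) ≤ germFieldVal p (germFieldNumbering p y) ↔
      FieldExpr.LE p x y := by
  rw [restrictVal_le_iff, FieldExpr.LE, ← germValuation_ringGerm_le_iff, ringGerm_mul, ringGerm_mul]
  exact germValuation_div_le_div_iff p (ringGerm_normalize_ne_zero p x)
    (ringGerm_normalize_ne_zero p y)

theorem PrimrecRel.fieldExpr_LE : PrimrecRel (FieldExpr.LE p) := by
  have hx := (Primrec.fieldExpr_normalize p).comp (Primrec.fst (α := FieldExpr) (β := FieldExpr))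
  have hy := (Primrec.fieldExpr_normalize p).comp (Primrec.snd (α := FieldExpr) (β := FieldExpr))
  have hm := Primrec.ringExpr_mul
  exact ((PrimrecPred.ringExpr_LE hp.out).comp
    ((hm.comp (Primrec.fst.comp hx) (Primrec.snd.comp hy)).pair
      (hm.comp (Primrec.fst.comp hy) (Primrec.snd.comp hx)))).primrecRel

theorem fieldExpr_zero_LE_iff (x : FieldExpr) :
    FieldExpr.LE p (RingExpr.zero, RingExpr.one) x ↔ germFieldNumbering p x = 0 := by
  have h0 : germFieldNumbering p (RingExpr.zero, RingExpr.one) = 0 :=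
    Subtype.ext ((fieldGerm_mk_one p _).trans (ringGerm_zero p))
  rw [← germFieldVal_le_iff, h0, AddValuation.map_zero, top_le_iff, AddValuation.top_iff]

theorem germFieldNumbering_eq_iff (x y : FieldExpr) :
    germFieldNumbering p x = germFieldNumbering p y ↔
      FieldExpr.LE p (RingExpr.zero, RingExpr.one) (FieldExpr.add p x (FieldExpr.neg p y)) := by
  rw [fieldExpr_zero_LE_iff, germFieldNumbering_add, germFieldNumbering_neg, ← sub_eq_add_neg,
    sub_eq_zero]

open Classical in
theorem Computable.decide_germFieldNumbering_eq :
    Computable₂ fun x y => decide (germFieldNumbering p x = germFieldNumbering p y) := by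
  have h : PrimrecPred fun z : FieldExpr × FieldExpr =>
      germFieldNumbering p z.1 = germFieldNumbering p z.2 :=
    ((PrimrecRel.fieldExpr_LE p).comp (Primrec.const (RingExpr.zero, RingExpr.one))
      ((Primrec.fieldExpr_add p).comp Primrec.fst
        ((Primrec.fieldExpr_neg p).comp Primrec.snd))).of_eq fun z =>
      (germFieldNumbering_eq_iff p z.1 z.2).symm
  exact h.decide.to_comp

/-! ### The value group -/

open Classical in
/-- Replaces formal quotients denoting `0` by `1`. -/
noncomputable def FieldExpr.normalizeUnit (x : FieldExpr) : FieldExpr :=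
  if FieldExpr.LE p (RingExpr.zero, RingExpr.one) x then (RingExpr.one, RingExpr.one) else x

open Classical in
theorem Primrec.fieldExpr_normalizeUnit : Primrec (FieldExpr.normalizeUnit p) :=
  Primrec.ite ((PrimrecRel.fieldExpr_LE p).comp (Primrec.const (RingExpr.zero, RingExpr.one))
    Primrec.id) (Primrec.const (RingExpr.one, RingExpr.one)) Primrec.id

theorem germFieldNumbering_normalizeUnit_ne_zero (x : FieldExpr) :
    germFieldNumbering p (FieldExpr.normalizeUnit p x) ≠ 0 := by
  have h1 : germFieldNumbering p (RingExpr.one, RingExpr.one) = 1 :=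
    Subtype.ext ((fieldGerm_mk_one p _).trans (ringGerm_one p))
  unfold FieldExpr.normalizeUnit
  split_ifs with h
  · rw [h1]; exact one_ne_zero
  · exact mt (fieldExpr_zero_LE_iff p x).2 h

theorem normalizeUnit_of_ne_zero {x : FieldExpr} (hx : germFieldNumbering p x ≠ 0) :
    FieldExpr.normalizeUnit p x = x :=
  if_neg (mt (fieldExpr_zero_LE_iff p x).1 hx)

/-- The numbering of the value group by formal quotients. -/
noncomputable def valueNumbering (x : FieldExpr) : valueSubgroup (germValuation p) (germField p) :=
  (germFieldVal p (germFieldNumbering p (FieldExpr.normalizeUnit p x))).untop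
    (mt (AddValuation.top_iff _).1 (germFieldNumbering_normalizeUnit_ne_zero p x))

theorem coe_valueNumbering (x : FieldExpr) : (valueNumbering p x : WithTop _) =
    germFieldVal p (germFieldNumbering p (FieldExpr.normalizeUnit p x)) :=
  WithTop.coe_untop _ _

theorem valueNumbering_eq_of_val_eq {x : FieldExpr}
    {g : valueSubgroup (germValuation p) (germField p)}
    (h : germFieldVal p (germFieldNumbering p x) = (g : WithTop _)) : valueNumbering p x = g := by
  have hx : germFieldNumbering p x ≠ 0 := by
    intro h0
    rw [h0, AddValuation.map_zero] at h
    exact WithTop.top_ne_coe h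
  rw [← WithTop.coe_inj, coe_valueNumbering, normalizeUnit_of_ne_zero p hx, h]

theorem valueNumbering_surjective : Function.Surjective (valueNumbering p) := by
  intro g
  obtain ⟨y, hy⟩ := restrictVal_surjective (germValuation p) (germField p) (g : WithTop _)
  obtain ⟨x, rfl⟩ := germFieldNumbering_surjective p y
  exact ⟨x, valueNumbering_eq_of_val_eq p hy⟩

theorem valueNumbering_le_iff (x y : FieldExpr) : valueNumbering p x ≤ valueNumbering p y ↔
    FieldExpr.LE p (FieldExpr.normalizeUnit p x) (FieldExpr.normalizeUnit p y) := by
  rw [← germFieldVal_le_iff, ← coe_valueNumbering, ← coe_valueNumbering, WithTop.coe_le_coe]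

/-- Multiplication of formal quotients, those denoting `0` being replaced by `1`. -/
noncomputable def FieldExpr.unitMul (x y : FieldExpr) : FieldExpr :=
  mul p (normalizeUnit p x) (normalizeUnit p y)

theorem Primrec.fieldExpr_unitMul : Primrec₂ (FieldExpr.unitMul p) :=
  (Primrec.fieldExpr_mul p).comp ((Primrec.fieldExpr_normalizeUnit p).comp Primrec.fst)
    ((Primrec.fieldExpr_normalizeUnit p).comp Primrec.snd)

theorem valueNumbering_unitMul (x y : FieldExpr) :
    valueNumbering p (FieldExpr.unitMul p x y) = valueNumbering p x + valueNumbering p y :=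
  valueNumbering_eq_of_val_eq p (by
    rw [FieldExpr.unitMul, germFieldNumbering_mul, AddValuation.map_mul, ← coe_valueNumbering, ← coe_valueNumbering,
      WithTop.coe_add])

theorem PrimrecRel.valueNumbering_le :
    PrimrecRel fun x y => valueNumbering p x ≤ valueNumbering p y :=
  ((PrimrecRel.fieldExpr_LE p).comp ((Primrec.fieldExpr_normalizeUnit p).comp Primrec.fst)
    ((Primrec.fieldExpr_normalizeUnit p).comp Primrec.snd)).of_eq fun z =>
      (valueNumbering_le_iff p z.1 z.2).symm

open Classical in
theorem Computable.decide_valueNumbering_eq :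
    Computable₂ fun x y => decide (valueNumbering p x = valueNumbering p y) := by
  have hle : PrimrecPred fun z : FieldExpr × FieldExpr =>
    valueNumbering p z.1 ≤ valueNumbering p z.2 := PrimrecRel.valueNumbering_le p
  have hge : PrimrecPred fun z : FieldExpr × FieldExpr =>
    valueNumbering p z.2 ≤ valueNumbering p z.1 :=
      (PrimrecRel.valueNumbering_le p).comp Primrec.snd Primrec.fst
  have h : PrimrecPred fun z : FieldExpr × FieldExpr =>
      valueNumbering p z.1 = valueNumbering p z.2 :=
    (hle.and hge).of_eq fun z => le_antisymm_iff.symm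
  exact h.decide.to_comp

open Classical in
/-- `germField` as a computable valued field. -/
noncomputable def germComputableField : ComputableValuedField where
  K := germField p
  Γ := valueSubgroup (germValuation p) (germField p)
  v := germFieldVal p
  surjective := restrictVal_surjective _ _
  domK := ComputableDomain.ofNumbering (germFieldNumbering_surjective p)
    (Computable.decide_germFieldNumbering_eq p) fun _ _ => decide_eq_true_iff
  domΓ := ComputableDomain.ofNumbering (valueNumbering_surjective p)
    (Computable.decide_valueNumbering_eq p) fun _ _ => decide_eq_true_iff
  add_computable := ComputableDomain.ofNumbering_computableOp _ _ _
    (Primrec.fieldExpr_add p).to_comp (germFieldNumbering_add p)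
  mul_computable := ComputableDomain.ofNumbering_computableOp _ _ _
    (Primrec.fieldExpr_mul p).to_comp (germFieldNumbering_mul p)
  group_add_computable := ComputableDomain.ofNumbering_computableOp _ _ _
    (Primrec.fieldExpr_unitMul p).to_comp (valueNumbering_unitMul p)
  group_le_computable := ComputableDomain.ofNumbering_computableRel _ _ _
    (PrimrecRel.decide (PrimrecRel.valueNumbering_le p)).to_comp fun _ _ => decide_eq_true_iff
  v_computable := ⟨_, (ComputableDomain.ofNumbering_computable (valueNumbering_surjective p)
      (Computable.decide_valueNumbering_eq p) fun _ _ => decide_eq_true_iff).comp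
      Computable.decodeNumbering, fun x γ h => by
    rw [valueNumbering_eq_of_val_eq p (g := γ) (by
      rw [ComputableDomain.ofNumbering_decode (germFieldNumbering_surjective p)]; exact h)]⟩

end

/-! ### Algebraic properties of `germField` -/

section

variable (p : ℕ)

noncomputable def monomialGerm (l : List ℕ) : RatGerm := ratGerm fun j => (evalMonomial p l j : ℚ)

noncomputable def posGerm (P : PosExpr) : RatGerm := ratGerm fun j => (evalPos p P j : ℚ)

theorem ringGerm_eq_sub (a : RingExpr) : ringGerm p a = posGerm p a.1 - posGerm p a.2 := by
  simp only [ringGerm, posGerm, ← map_sub, evalRing, Int.cast_sub, Int.cast_natCast]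
  rfl

theorem monomialGerm_cons (s : ℕ) (l : List ℕ) : monomialGerm p (s :: l) =
    ringGerm p (RingExpr.generator s) * monomialGerm p l := by
  rw [ringGerm_generator]
  simp only [monomialGerm, ← map_mul, evalMonomial, List.map_cons, List.sum_cons, pow_add,
    Nat.cast_mul, Nat.cast_pow]
  rfl

theorem posGerm_cons (l : List ℕ) (P : PosExpr) :
    posGerm p (l :: P) = monomialGerm p l + posGerm p P := by
  simp only [posGerm, monomialGerm, ← map_add, evalPos_cons, Nat.cast_add]
  rfl

theorem ringGerm_mem {S : Subfield RatGerm} (h : ∀ s, ringGerm p (RingExpr.generator s) ∈ S)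
    (a : RingExpr) : ringGerm p a ∈ S := by
  have hmono (l : List ℕ) : monomialGerm p l ∈ S := by
    induction l with
    | nil =>
      have : monomialGerm p [] = 1 := by
        rw [← map_one ratGerm, monomialGerm]
        congr 1
      rw [this]
      exact S.one_mem
    | cons s l ih => rw [monomialGerm_cons]; exact S.mul_mem (h s) ih
  have hpos (P : PosExpr) : posGerm p P ∈ S := by
    induction P with
    | nil =>
      have : posGerm p [] = 0 := by
        rw [← map_zero ratGerm, posGerm]
        congr 1
      rw [this]
      exact S.zero_mem
    | cons l P ih => rw [posGerm_cons]; exact S.add_mem (hmono l) ih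
  rw [ringGerm_eq_sub]
  exact S.sub_mem (hpos _) (hpos _)

variable [hp : Fact p.Prime]

theorem germField_le {S : Subfield RatGerm} (h : ∀ s, ringGerm p (RingExpr.generator s) ∈ S) :
    germField p ≤ S := by
  rintro _ ⟨x, rfl⟩
  exact S.div_mem (ringGerm_mem p h _) (ringGerm_mem p h _)

/-- The generators of `germField`. -/
noncomputable def germGenerator (s : ℕ) : germField p :=
  ⟨ringGerm p (RingExpr.generator s), (RingExpr.generator s, RingExpr.one), fieldGerm_mk_one p _⟩

theorem coe_germGenerator (s : ℕ) :
    (germGenerator p s : RatGerm) = ratGerm fun j => (p : ℚ) ^ stageExponent s j :=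
  ringGerm_generator p s

/-- This algebraic relation carries the congruence on the value of the transcendental into every
extension field. -/
theorem germGenerator_zero_eq (s : ℕ) :
    germGenerator p 0 = (p : germField p) ^ stageResidue s * germGenerator p s ^ stageModulus s := by
  apply Subtype.ext
  push_cast
  have hpc : (p : RatGerm) = ratGerm fun _ => (p : ℚ) := by rw [ratGerm_const]; norm_cast
  rw [coe_germGenerator, coe_germGenerator, hpc, ← map_pow, ← map_pow, ← map_mul, ratGerm_eq_iff]
  refine eventually_hyperfilter_of_le s fun j hj => ?_
  simp only [Pi.mul_apply, Pi.pow_apply]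
  rw [stageExponent_zero hj, pow_add, mul_comm (stageModulus s), pow_mul]

/-- A nonzero integer polynomial has a value of finite valuation, hence nonzero, at every large
power of `p`. -/
theorem transcendental_germGenerator_zero : Transcendental ℤ (germGenerator p 0) := by
  rw [transcendental_iff]
  intro F hF
  by_contra hF0
  have h1 : Polynomial.aeval (germGenerator p 0 : RatGerm) F = 0 := by
    have := congrArg (germField p).subtype.toIntAlgHom hF
    rwa [← Polynomial.aeval_algHom_apply, map_zero] at this
  have h2 : ratGerm (Polynomial.aeval (fun j => (p : ℚ) ^ stageExponent 0 j) F) = 0 := by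
    rw [coe_germGenerator] at h1
    rw [← h1]
    exact (Polynomial.aeval_algHom_apply ratGerm.toIntAlgHom _ F).symm
  obtain ⟨d, a, h⟩ := F.exists_eval_prime_pow hp.out hF0
    (H := F.support.sup fun i => (F.coeff i).natAbs) fun i => by
      by_cases hi : i ∈ F.support
      · exact Finset.le_sup (f := fun i => (F.coeff i).natAbs) hi
      · simp [Polynomial.notMem_support_iff.1 hi]
  obtain ⟨j, hj, hle⟩ := ((ratGerm_eq_zero_iff.1 h2).and (eventually_hyperfilter_of_le
    (F.support.sup fun i => (F.coeff i).natAbs) fun j hj => hj)).exists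
  obtain ⟨-, w, hw, hev⟩ := h (stageExponent 0 j)
    ((hle.trans (le_stageExponent (Nat.zero_le j))).trans_lt (Nat.lt_pow_self hp.out.one_lt))
  have h3 : Polynomial.aeval ((p : ℚ) ^ stageExponent 0 j) F = 0 := by
    rw [← hj]
    exact Polynomial.aeval_algHom_apply (Pi.evalRingHom (fun _ : ℕ => ℚ) j).toIntAlgHom
      (fun j => (p : ℚ) ^ stageExponent 0 j) F
  have h4 : ((F.eval ((p : ℤ) ^ stageExponent 0 j) : ℤ) : ℚ) = 0 := by
    have := Polynomial.aeval_algebraMap_apply ℚ ((p : ℤ) ^ stageExponent 0 j) F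
    simp only [Polynomial.coe_aeval_eq_eval, eq_intCast, Int.cast_pow, Int.cast_natCast] at this
    rw [← this, h3]
  rw [Int.cast_eq_zero, hev, mul_eq_zero] at h4
  rcases h4 with h4 | h4
  · exact pow_ne_zero _ (by exact_mod_cast hp.out.ne_zero) h4
  · exact hw (h4 ▸ dvd_zero _)

theorem nsmul_val_prime_lt_val_germGenerator_zero (n : ℕ) :
    n • germFieldVal p (p : germField p) < germFieldVal p (germGenerator p 0) := by
  rw [← AddValuation.map_pow, ← not_le, restrictVal_le_iff, coe_germGenerator]
  push_cast
  have h1 : (p : RatGerm) ^ n = ratGerm fun _ => (((p : ℤ) ^ n : ℤ) : ℚ) := by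
    rw [ratGerm_const]; norm_cast
  have h2 : (ratGerm fun j => (p : ℚ) ^ stageExponent 0 j) =
      ratGerm fun j => (((p : ℤ) ^ stageExponent 0 j : ℤ) : ℚ) := by
    congr 1; ext j; push_cast; rfl
  rw [h1, h2, germValuation_intCast_le_iff, ← Ultrafilter.eventually_not]
  refine eventually_hyperfilter_of_le (n + 1) fun j hj hle => ?_
  have := hle (n + 1) (pow_dvd_pow _ (hj.trans (le_stageExponent (Nat.zero_le j))))
  have hp' : Prime (p : ℤ) := Nat.prime_iff_prime_int.1 hp.out
  exact absurd ((pow_dvd_pow_iff hp'.ne_zero hp'.not_isUnit).1 this) (by omega)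

theorem isAlgebraic_germField :
    Algebra.IsAlgebraic (Subfield.closure {germGenerator p 0}) (germField p) := by
  set k := Subfield.closure {germGenerator p 0} with hk
  have hgen (s : ℕ) : IsAlgebraic k (germGenerator p s) := by
    refine IsAlgebraic.of_pow (stageModulus_pos s) ?_
    have hp0 : (p : germField p) ≠ 0 := by exact_mod_cast hp.out.ne_zero
    have : germGenerator p s ^ stageModulus s ∈ k := by
      have h : germGenerator p s ^ stageModulus s =
          germGenerator p 0 / (p : germField p) ^ stageResidue s := by
        rw [germGenerator_zero_eq p s]; field_simp
      rw [h]
      exact k.div_mem (Subfield.subset_closure rfl) (pow_mem (natCast_mem k p) _)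
    exact isAlgebraic_algebraMap (⟨_, this⟩ : k)
  have hle : germField p ≤
      (algebraicClosure k (germField p)).toSubfield.map (germField p).subtype :=
    germField_le p fun s => ⟨germGenerator p s, (mem_algebraicClosure_iff).2 (hgen s), rfl⟩
  refine ⟨fun x => ?_⟩
  obtain ⟨y, hy, hyx⟩ := hle x.2
  rw [← Subtype.ext hyx]
  exact mem_algebraicClosure_iff.1 hy

end

/-! ### Residues in a computable model of Presburger arithmetic -/

section Presburger

theorem ComputableDomain.ComputableOp.nsmul {Γ : Type} [AddCommGroup Γ] {d : ComputableDomain Γ}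
    (h : d.ComputableOp fun a b : Γ => a + b) :
    ∃ S : ℕ → ℕ → ℕ, Computable₂ S ∧ ∀ (n : ℕ) (y : Γ), S n (d.code y) = d.code (n • y) := by
  obtain ⟨F, hF, hFadd⟩ := h
  refine ⟨fun n m => Nat.rec (d.code 0) (fun _ c => F c m) n, ?_, fun n y => ?_⟩
  · exact Computable.nat_rec (f := fun z : ℕ × ℕ => z.1) (g := fun _ => d.code 0)
      (h := fun z w => F w.2 z.2) Computable.fst (Computable.const _) (Computable₂.mk (hF.comp (Computable.snd.comp Computable.snd)
        (Computable.snd.comp Computable.fst)))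
  · beta_reduce
    induction n with
    | zero => simp
    | succ n ih =>
      change F (Nat.rec (d.code 0) (fun _ c => F c (d.code y)) n) (d.code y) = _
      rw [ih, hFadd, succ_nsmul]

/-- In a computable ordered group with division with remainder, the remainders of a fixed element
are a computable function of the modulus. -/
theorem exists_computable_remainder {Γ : Type} [AddCommGroup Γ] {d : ComputableDomain Γ}
    (hadd : d.ComputableOp fun a b : Γ => a + b) (e x : Γ)
    (hdiv : ∀ n : ℕ, 0 < n → ∃ (y : Γ) (r : ℕ), r < n ∧ x = n • y + r • e)
    {q : ℕ → ℕ} (hq : Computable q) (hq0 : ∀ n, 0 < q n) :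
    ∃ g : ℕ → ℕ, Computable g ∧ ∀ n, g n < q n ∧ ∃ y : Γ, x = q n • y + g n • e := by
  obtain ⟨S, hS, hSn⟩ := hadd.nsmul
  obtain ⟨F, hF, hFadd⟩ := hadd
  obtain ⟨D, hD, hDr⟩ := ComputablePred.computable_iff.1 d.computable_range
  have hDr' (n : ℕ) : D n = true ↔ n ∈ Set.range d.code := (congrFun hDr n) ▸ Iff.rfl
  -- The number `m` codes a candidate quotient and remainder. `D` rejects numbers that are not codes
  -- of group elements, where `F` and `S` have no meaning.
  let T (n m : ℕ) : Bool := D m.unpair.1 && (decide (m.unpair.2 < q n) &&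
    decide (F (S (q n) m.unpair.1) (S m.unpair.2 (d.code e)) = d.code x))
  have hT : Computable₂ T := by
    have h1 : Computable fun z : ℕ × ℕ => z.2.unpair.1 :=
      Computable.fst.comp (Computable.unpair.comp Computable.snd)
    have h2 : Computable fun z : ℕ × ℕ => z.2.unpair.2 :=
      Computable.snd.comp (Computable.unpair.comp Computable.snd)
    have hqz : Computable fun z : ℕ × ℕ => q z.1 := hq.comp Computable.fst
    exact Primrec.and.to_comp.comp (hD.comp h1) (Primrec.and.to_comp.comp
      (Primrec.nat_lt.decide.to_comp.comp h2 hqz)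
      (Primrec.eq.decide.to_comp.comp
        (hF.comp (hS.comp hqz h1) (hS.comp h2 (Computable.const _))) (Computable.const _)))
  have hTspec (n m : ℕ) : T n m = true ↔
      m.unpair.2 < q n ∧ ∃ y : Γ, d.code y = m.unpair.1 ∧ x = q n • y + m.unpair.2 • e := by
    simp only [T, Bool.and_eq_true, decide_eq_true_eq, hDr', Set.mem_range]
    constructor
    · rintro ⟨⟨y, hy⟩, hlt, h⟩
      rw [← hy, hSn, hSn, hFadd] at h
      exact ⟨hlt, y, hy, (d.code.injective h).symm⟩
    · rintro ⟨hlt, y, hy, h⟩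
      refine ⟨⟨y, hy⟩, hlt, ?_⟩
      rw [← hy, hSn, hSn, hFadd]
      exact congrArg d.code h.symm
  have hex (n : ℕ) : ∃ m, T n m = true := by
    obtain ⟨y, r, hr, h⟩ := hdiv (q n) (hq0 n)
    exact ⟨Nat.pair (d.code y) r, (hTspec _ _).2 (by simpa using ⟨hr, h⟩)⟩
  refine ⟨fun n => (Nat.find (hex n)).unpair.2, ?_, fun n => ?_⟩
  · have hc : ComputablePred fun z : ℕ × ℕ => T z.1 z.2 = true :=
      ComputablePred.computable_iff.2 ⟨fun z => T z.1 z.2, hT, rfl⟩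
    exact Computable.snd.comp (Computable.unpair.comp (Computable.find hc hex))
  · obtain ⟨h1, y, -, h2⟩ := (hTspec _ _).1 (Nat.find_spec (hex n))
    exact ⟨h1, y, h2⟩

/-- Remainders are unique when `e` is the least positive element. -/
theorem modEq_of_nsmul_add_eq {Γ : Type} [AddCommGroup Γ] [LinearOrder Γ] [IsOrderedAddMonoid Γ]
    {e : Γ} (he : IsLeast {g : Γ | 0 < g} e) {q r s : ℕ} (hq : 0 < q) {y z : Γ}
    (h : q • y + r • e = q • z + s • e) : r ≡ s [MOD q] := by
  set b : ℤ := ((r : ℤ) - s) % q with hb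
  have hb0 : 0 ≤ b := Int.emod_nonneg _ (by omega)
  have hbq : b < q := Int.emod_lt_of_pos _ (by omega)
  have hdiv : ((r : ℤ) - s) = q * (((r : ℤ) - s) / q) + b := (Int.mul_ediv_add_emod _ _).symm
  -- With `0 ≤ b < q`, the element `b • e` is `q` times some element. Were `b` positive, that
  -- element would be positive, hence at least `e`, giving `q • e ≤ b • e`.
  have h1 : (q : ℤ) • (z - y - (((r : ℤ) - s) / q) • e) = b • e := by
    have h2 : ((r : ℤ) - s) • e = (q : ℤ) • (z - y) := by
      rw [sub_smul, smul_sub, natCast_zsmul, natCast_zsmul, natCast_zsmul, natCast_zsmul,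
        sub_eq_sub_iff_add_eq_add, add_comm, h]
    rw [smul_sub, ← h2, smul_smul, ← sub_smul]
    congr 1
    linarith
  have hb' : b = 0 := by
    by_contra hne
    have hbpos : 0 < b := lt_of_le_of_ne hb0 (Ne.symm hne)
    have hpos : 0 < z - y - (((r : ℤ) - s) / q) • e := by
      by_contra! hle
      have := nsmul_nonpos hle q
      rw [← natCast_zsmul, h1] at this
      exact absurd this (not_le.2 (zsmul_pos he.1 hbpos))
    have hge := zsmul_le_zsmul_right (by omega : (0 : ℤ) ≤ q) (he.2 hpos)
    rw [h1] at hge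
    exact absurd hge (not_le.2 (zsmul_lt_zsmul_left he.1 hbq))
  refine ((Nat.modEq_iff_dvd).2 ?_).symm
  exact Int.dvd_of_emod_eq_zero hb'

end Presburger

/-! ### The diagonal argument and the main theorem -/

/-- There is no ring homomorphism from `germField` to a computable formally `p`-adic field whose
value group is a model of Presburger arithmetic. -/
theorem not_exists_ringHom_germField (p : ℕ) [hp : Fact p.Prime] (L : ComputableValuedField)
    (hL : IsFormallyPAdic p L.v) (hP : IsPresburgerGroup L.Γ) (f : germField p →+* L.K) : False := by
  obtain ⟨-, γ, -, -, hγp, hγ⟩ := hL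
  obtain ⟨e, he, hdiv⟩ := hP
  obtain rfl : e = γ := he.unique hγ
  have hval (x : germField p) (hx : x ≠ 0) : ∃ g : L.Γ, L.v (f x) = (g : WithTop L.Γ) := by
    have : L.v (f x) ≠ ⊤ := mt (AddValuation.top_iff _).1 ((map_ne_zero f).2 hx)
    obtain ⟨g, hg⟩ := WithTop.ne_top_iff_exists.1 this
    exact ⟨g, hg.symm⟩
  have hgen (s : ℕ) : germGenerator p s ≠ 0 := by
    intro h
    have h0 := germGenerator_zero_eq p s
    rw [h, zero_pow (stageModulus_pos s).ne', mul_zero] at h0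
    exact transcendental_germGenerator_zero p (h0 ▸ isAlgebraic_zero)
  obtain ⟨τ, hτ⟩ := hval _ (hgen 0)
  obtain ⟨g, hg, hgτ⟩ := exists_computable_remainder L.group_add_computable e τ (hdiv τ)
    Primrec.fermatNumber.to_comp fun n => by have := Nat.three_le_fermatNumber n; omega
  -- Differs from `g` everywhere, and its values `0` and `1` are below every Fermat number, so a
  -- congruence with `g n` becomes an equality.
  let h (n : ℕ) : ℕ := if g n = 0 then 1 else 0
  have hh : Computable h :=
    (Primrec.ite (Primrec.eq.comp Primrec.id (Primrec.const 0)) (Primrec.const 1)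
      (Primrec.const 0)).to_comp.comp hg
  obtain ⟨c, hc⟩ := Code.exists_code.1 (Partrec.nat_iff.1 hh.partrec)
  -- The index of a program for `h`, at which the construction has observed `h n`.
  set n := Encodable.encode c with hn
  have hmem : h n ∈ Code.eval (Denumerable.ofNat Code n) n := by
    rw [hn, Denumerable.ofNat_encode, hc]
    exact Part.mem_some _
  obtain ⟨s, ⟨m, hm⟩, hs⟩ := exists_stage_of_mem_eval hmem
  obtain ⟨u, hu⟩ := hval _ (hgen s)
  have hτu : τ = n.fermatNumber • (m • u) + stageResidue s • e := by
    have h1 := congrArg (fun x => L.v (f x)) (germGenerator_zero_eq p s)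
    simp only [map_mul, map_pow, map_natCast, AddValuation.map_mul, AddValuation.map_pow] at h1
    rw [hτ, hγp, hu, hm, ← WithTop.coe_nsmul, ← WithTop.coe_nsmul, ← WithTop.coe_add,
      WithTop.coe_inj] at h1
    rw [h1, add_comm, mul_nsmul']
  obtain ⟨hlt, y, hy⟩ := hgτ n
  have h3 := Nat.three_le_fermatNumber n
  have hmod : g n ≡ h n [MOD n.fermatNumber] :=
    (modEq_of_nsmul_add_eq he (by omega) (hy.symm.trans hτu)).trans hs
  have heq : g n = h n := Nat.ModEq.eq_of_lt_of_lt hmod hlt (by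
    simp only [h]; split_ifs <;> omega)
  simp only [h] at heq
  split_ifs at heq with h0 <;> omega

/-- Transcendence over `ℤ` is the same as over `ℚ`, and the subfield closure of `{t}` is `ℚ(t)`
since it contains the prime field. -/
theorem mainTheorem2 (p : ℕ) (hp : p.Prime) :
    ∃ E : ComputableValuedField,
      IsFormallyPAdic p E.v ∧
      (∃ t : E.K, Transcendental ℤ t ∧
        (∀ n : ℕ, n • E.v (p : E.K) < E.v t) ∧
        Algebra.IsAlgebraic (Subfield.closure {t}) E.K) ∧
      ∀ L : ComputableValuedField, IsPAdicallyClosed p L.v →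
        ¬ ∃ f : E.K →+* L.K, IsValuedFieldEmbedding E L f := by
  have : Fact p.Prime := ⟨hp⟩
  refine ⟨germComputableField p, isFormallyPAdic_restrictVal p (germField p),
    ⟨germGenerator p 0, transcendental_germGenerator_zero p,
      nsmul_val_prime_lt_val_germGenerator_zero p, isAlgebraic_germField p⟩, ?_⟩
  rintro L ⟨hL, -, hP⟩ ⟨f, -⟩
  exact not_exists_ringHom_germField p L hL hP f
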